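/- Let $G$ be a finite group acting (from the right, $y\mapsto y^\tau$) by automorphisms on a field $L$, with fixed field $K$; let $N$ be the kernel of this action, $n:=|N|$, $h:=[L:K]$, and suppose that $n$ is invertible in $K$. Let $L\wr G$ be the twisted group ring: the right $L$-vector space with basis $G$ and multiplication $(\sigma y)(\tau z)=(\sigma\tau)(y^\tau z)$ for $\sigma,\tau\in G$, $y,z\in L$. For $\nu\in N$ let $L_\nu:=\mathrm{Fix}_{C_G(\nu)}L$. For $y\in L_\nu$ the orbit sum $\sum_{\rho\in C_G(\nu)\backslash G}(\nu y)^\rho$, where $(\nu y)^\rho:=\rho^{-1}\nu\rho\cdot y^\rho$, lies in the centre $Z(L\wr G)$. Let $(X_i)_{i\in[1,k]}$ be a complete set of nonisomorphic simple right $L\wr G$-modules, $K_i:=\mathrm{End}_{L\wr G}X_i$, $x_i:=\dim_{K_i}X_i$ (as a left $K_i$-module), and let $d_i\ge 1$ be the integer with $d_i^2=[K_i:Z(K_i)]$. For $\xi\in Z(L\wr G)$ let $\xi\omega_i^Z\in Z(K_i)$ denote the operation of $\xi$ on $X_i$. **Proposition (central Plancherel formula).** There is a unique $K$-bilinear form $(-,=)^Z$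 on $Z(L\wr G)$ such that, for all $\nu,\nu'\in N$, $y\in L_\nu$, $y'\in L_{\nu'}$, $$\Big(\sum_{\rho\in C_G(\nu)\backslash G}(\nu y)^\rho,\ \sum_{\rho'\in C_G(\nu')\backslash G}(\nu' y')^{\rho'}\Big)^{Z}=\begin{cases}[N:C_N(\nu)]\cdot\mathrm{Tr}_{L_\nu/K}(y\,y'^\tau)&\text{if }\nu=\tau^{-1}\nu'^{-1}\tau\text{ with }\tau\in G,\\ 0&\text{if }\nu\text{ and }\nu'^{-1}\text{ are not conjugate in }G,\end{cases}$$ and this form is symmetric. For each $i$ the integer $d_i$ exists (that is, $[K_i:Z(K_i)]$ is a perfect square), and $h$ divides $x_id_i$. For all $\xi,\xi'\in Z(L\wr G)$, $$(\xi,\xi')^Z=\sum_{i\in[1,k]}\frac1n\Big(\frac{x_id_i}{h}\Big)^2\,\mathrm{Tr}_{Z(K_i)/K}\big(\xi\omega_i^Z\cdot\xi'\omega_i^Z\big),$$ where the integers $x_id_i/h$ are mapped to $K$. -/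

import Mathlib

open scoped RightActions

universe u v w

/-- The twisted group ring `L ≀ G` of a group `G` acting on a field `L` from the right, where
`τ : G` sends `y : L` to `y <• τ`.  It is free as a right `L`-module on the set `G`, with product
determined by `(σ y) (τ z) = (σ τ) ((y <• τ) z)`; see `TwistedGroupRing.single_mul_single`.
Mathlib's skew monoid algebra writes coefficients on the left and lets the monoid act from the
left, so `L ≀ G` is the opposite ring of the skew monoid algebra of the opposite group.
Right `L ≀ G`-modules are modules over `(TwistedGroupRing L G)ᵐᵒᵖ`. -/
def TwistedGroupRing (L G : Type*) [Field L] [Group G] [MulSemiringAction Gᵐᵒᵖ L] : Type _ :=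
  (SkewMonoidAlgebra L Gᵐᵒᵖ)ᵐᵒᵖ

namespace TwistedGroupRing

/-- The fixed field `K` of the right action of `G` on `L`. -/
abbrev baseField (L G : Type*) [Field L] [Group G] [MulSemiringAction Gᵐᵒᵖ L] : Subfield L :=
  FixedPoints.subfield Gᵐᵒᵖ L

noncomputable instance instRing (L G : Type*) [Field L] [Group G] [MulSemiringAction Gᵐᵒᵖ L] :
    Ring (TwistedGroupRing L G) :=
  inferInstanceAs (Ring (SkewMonoidAlgebra L Gᵐᵒᵖ)ᵐᵒᵖ)

/-- `L ≀ G` is an algebra over the fixed field `K`. -/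
noncomputable instance instAlgebra (L G : Type*) [Field L] [Group G] [MulSemiringAction Gᵐᵒᵖ L] :
    Algebra (baseField L G) (TwistedGroupRing L G) :=
  inferInstanceAs (Algebra (FixedPoints.subfield Gᵐᵒᵖ L) (SkewMonoidAlgebra L Gᵐᵒᵖ)ᵐᵒᵖ)

/-- The kernel `N` of the right action of `G` on `L`. -/
def kernel (L G : Type*) [Field L] [Group G] [MulSemiringAction Gᵐᵒᵖ L] : Subgroup G :=
  (MulSemiringAction.toRingAut Gᵐᵒᵖ L).ker.unop

section

variable {L G : Type*} [Field L] [Group G] [MulSemiringAction Gᵐᵒᵖ L]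

theorem mem_kernel {σ : G} : σ ∈ kernel L G ↔ ∀ y : L, y <• σ = y := by
  simp [kernel, MonoidHom.mem_ker, RingEquiv.ext_iff]

/-- The element `σ y` of `L ≀ G`. -/
noncomputable def single (σ : G) (y : L) : TwistedGroupRing L G :=
  MulOpposite.op (SkewMonoidAlgebra.single (MulOpposite.op σ) y)

theorem single_mul_single (σ τ : G) (y z : L) :
    single σ y * single τ z = single (σ * τ) ((y <• τ) * z) := by
  refine MulOpposite.unop_injective ?_
  change SkewMonoidAlgebra.single (MulOpposite.op τ) z *
    SkewMonoidAlgebra.single (MulOpposite.op σ) y = SkewMonoidAlgebra.single _ _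
  rw [SkewMonoidAlgebra.single_mul_single, mul_comm z, MulOpposite.op_mul]

theorem one_eq_single : (1 : TwistedGroupRing L G) = single 1 1 := rfl

theorem algebraMap_eq_single (c : baseField L G) :
    algebraMap (baseField L G) (TwistedGroupRing L G) c = single 1 (c : L) := rfl

theorem induction_single {p : TwistedGroupRing L G → Prop} (ξ : TwistedGroupRing L G)
    (hs : ∀ σ y, p (single σ y)) (ha : ∀ ξ η, p ξ → p η → p (ξ + η)) : p ξ := by
  suffices h : ∀ f : SkewMonoidAlgebra L Gᵐᵒᵖ, p (MulOpposite.op f) from h (MulOpposite.unop ξ)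
  intro f
  induction f using SkewMonoidAlgebra.induction_on' with
  | single g a => exact hs g.unop a
  | add f g hf hg => exact ha _ _ hf hg

/-- The field `L_ν` of elements of `L` fixed by the centralizer `C_G(ν)`. -/
abbrev centralizerField (L : Type*) {G : Type*} [Field L] [Group G] [MulSemiringAction Gᵐᵒᵖ L]
    (ν : G) : IntermediateField (baseField L G) L :=
  FixedPoints.intermediateField (Subgroup.centralizer {ν}).op

theorem mem_centralizerField {ν : G} {y : L} :
    y ∈ centralizerField L ν ↔ ∀ ρ : G, ν * ρ = ρ * ν → y <• ρ = y := by
  rw [FixedPoints.mem_intermediateField_iff]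
  constructor
  · intro h ρ hρ
    exact h ⟨MulOpposite.op ρ, by
      rw [Subgroup.mem_op, Subgroup.mem_centralizer_singleton_iff]; exact hρ.symm⟩
  · rintro h ⟨ρ, hρ⟩
    rw [Subgroup.mem_op, Subgroup.mem_centralizer_singleton_iff] at hρ
    exact h ρ.unop hρ.symm

theorem smul_mul_inv_mem {ν : G} {y : L} (hy : y ∈ centralizerField L ν) {a b : G}
    (h : b * a⁻¹ ∈ Subgroup.centralizer {ν}) :
    single (a⁻¹ * ν * a) (y <• a) = single (b⁻¹ * ν * b) (y <• b) := by
  rw [Subgroup.mem_centralizer_singleton_iff] at h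
  have h1 : y <• (b * a⁻¹) = y := mem_centralizerField.1 hy _ h.symm
  have h2 : y <• b = y <• a := by
    conv_rhs => rw [← h1]
    rw [← mul_smul, ← MulOpposite.op_mul, inv_mul_cancel_right]
  have h3 : a⁻¹ * ν * a = b⁻¹ * ν * b := by
    have : b⁻¹ * (b * a⁻¹ * ν) * a = b⁻¹ * (ν * (b * a⁻¹)) * a := by rw [h]
    simpa [mul_assoc] using this
  rw [h2, h3]

/-- The orbit sum `∑_{ρ ∈ C_G(ν)\G} (ν y)^ρ`, with `(ν y)^ρ = (ρ⁻¹ ν ρ) (y <• ρ)`, as an element of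
`L ≀ G`; the summand depends on the right coset `C_G(ν) ρ` only, since `y ∈ L_ν`. -/
noncomputable def orbitSumAux (ν : G) (y : centralizerField L ν) : TwistedGroupRing L G :=
  ∑ᶠ q : Quotient (QuotientGroup.rightRel (Subgroup.centralizer {ν})),
    Quotient.lift (fun ρ : G => single (ρ⁻¹ * ν * ρ) ((y : L) <• ρ))
      (fun _ _ h => smul_mul_inv_mem y.2 (QuotientGroup.rightRel_apply.1 h)) q

theorem orbitSumAux_mem_center [Finite G] {ν : G} (hν : ν ∈ kernel L G)
    (y : centralizerField L ν) :
    orbitSumAux ν y ∈ Subalgebra.center (baseField L G) (TwistedGroupRing L G) := by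
  rw [Subalgebra.mem_center_iff]
  intro b
  induction b using induction_single with
  | ha ξ η hξ hη => rw [add_mul, mul_add, hξ, hη]
  | hs τ z =>
    let e : Quotient (QuotientGroup.rightRel (Subgroup.centralizer {ν})) ≃
        Quotient (QuotientGroup.rightRel (Subgroup.centralizer {ν})) :=
      Quotient.congr (Equiv.mulRight τ) (fun a b => by
        change (QuotientGroup.rightRel _) a b ↔ (QuotientGroup.rightRel _) (a * τ) (b * τ)
        rw [QuotientGroup.rightRel_apply, QuotientGroup.rightRel_apply]
        simp [mul_assoc])
    rw [orbitSumAux, finsum_mul' _ _ (Set.toFinite _), mul_finsum' _ _ (Set.toFinite _),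
      ← finsum_comp_equiv e]
    refine finsum_congr fun q => ?_
    induction q using Quotient.inductionOn with
    | h ρ =>
      change single τ z * single ((ρ * τ)⁻¹ * ν * (ρ * τ)) ((y : L) <• (ρ * τ)) =
        single (ρ⁻¹ * ν * ρ) ((y : L) <• ρ) * single τ z
      rw [single_mul_single, single_mul_single]
      have hz : z <• ((ρ * τ)⁻¹ * ν * (ρ * τ)) = z := by
        rw [mul_assoc, MulOpposite.op_mul, MulOpposite.op_mul ν, mul_smul, mul_smul, mem_kernel.1 hν,
          ← mul_smul, ← MulOpposite.op_mul, inv_mul_cancel, MulOpposite.op_one, one_smul]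
      rw [hz, MulOpposite.op_mul, mul_smul, mul_comm z]
      congr 1
      group

/-- The orbit sum `∑_{ρ ∈ C_G(ν)\G} (ν y)^ρ` for `ν ∈ N` and `y ∈ L_ν`, as an element of the centre
of `L ≀ G`. -/
noncomputable def orbitSum [Finite G] (ν : kernel L G) (y : centralizerField L (ν : G)) :
    Subalgebra.center (baseField L G) (TwistedGroupRing L G) :=
  ⟨orbitSumAux (ν : G) y, orbitSumAux_mem_center ν.2 y⟩

/-- If `ν = (ν'⁻¹)^τ = τ⁻¹ ν'⁻¹ τ` and `y ∈ L_ν`, `y' ∈ L_ν'`, then `y (y' <• τ) ∈ L_ν`. -/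
theorem mul_smul_mem {ν ν' τ : G} (h : ν = τ⁻¹ * ν'⁻¹ * τ) {y y' : L}
    (hy : y ∈ centralizerField L ν) (hy' : y' ∈ centralizerField L ν') :
    y * (y' <• τ) ∈ centralizerField L ν := by
  refine mul_mem hy (mem_centralizerField.2 fun ρ hρ => ?_)
  have hc : Commute ν' (τ * ρ * τ⁻¹) := by
    have h1 : Commute (τ⁻¹ * ν'⁻¹ * τ) ρ := by rw [← h]; exact hρ
    have h2 : Commute (τ * (τ⁻¹ * ν'⁻¹ * τ) * τ⁻¹) (τ * ρ * τ⁻¹) := by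
      rw [Commute, SemiconjBy]
      have := h1.eq
      simp only [mul_assoc, inv_mul_cancel_left, mul_inv_cancel_left] at this ⊢
      rw [← mul_assoc τ ρ τ⁻¹]
      have h3 := congrArg (fun x => τ * x * τ⁻¹) this
      simpa [mul_assoc] using h3
    have h4 : τ * (τ⁻¹ * ν'⁻¹ * τ) * τ⁻¹ = ν'⁻¹ := by group
    rw [h4] at h2
    simpa using h2.inv_left
  have h5 := mem_centralizerField.1 hy' _ hc.eq
  conv_rhs => rw [← h5]
  rw [← mul_smul, ← mul_smul, ← MulOpposite.op_mul, ← MulOpposite.op_mul, inv_mul_cancel_right]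

/-- `B` is the form `(-,=)^Z` on the centre of `L ≀ G`: a `K`-bilinear form with prescribed values on
pairs of orbit sums, where `ν, ν' ∈ N`, `y ∈ L_ν` and `y' ∈ L_ν'`. -/
structure IsCentralForm [Finite G]
    (B : LinearMap.BilinForm (baseField L G)
      (Subalgebra.center (baseField L G) (TwistedGroupRing L G))) : Prop where
  /-- If `ν = (ν'⁻¹)^τ`, the value is `[N : C_N(ν)] Tr_{L_ν/K}(y (y' <• τ))`. -/
  apply_of_conj : ∀ (ν ν' : kernel L G) (y : centralizerField L (ν : G))
    (y' : centralizerField L (ν' : G)) (τ : G) (h : (ν : G) = τ⁻¹ * (ν' : G)⁻¹ * τ),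
    B (orbitSum ν y) (orbitSum ν' y') =
      ((Subgroup.centralizer {(ν : G)}).relIndex (kernel L G) : baseField L G) *
        Algebra.trace (baseField L G) (centralizerField L (ν : G))
          ⟨(y : L) * ((y' : L) <• τ), mul_smul_mem h y.2 y'.2⟩
  /-- If `ν` and `ν'⁻¹` are not conjugate in `G`, the value is `0`. -/
  apply_of_not_conj : ∀ (ν ν' : kernel L G) (y : centralizerField L (ν : G))
    (y' : centralizerField L (ν' : G)), ¬ IsConj (ν : G) (ν' : G)⁻¹ →
    B (orbitSum ν y) (orbitSum ν' y') = 0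

end

section

variable (L G : Type*) [Field L] [Group G] [MulSemiringAction Gᵐᵒᵖ L]
  (X : Type*) [AddCommGroup X] [Module (TwistedGroupRing L G)ᵐᵒᵖ X]

/-- The endomorphism ring `End_{L ≀ G} X` of a right `L ≀ G`-module `X`.  It acts on `X` from the
left. -/
abbrev EndRing : Type _ := Module.End (TwistedGroupRing L G)ᵐᵒᵖ X

/-- The dimension `x` of a simple module `X` as a left module over its endomorphism skew field. -/
noncomputable def dimEnd : ℕ := Module.finrank (EndRing L G X) X

/-- The integer `d` such that `d ^ 2` is the degree of `End_{L ≀ G} X` over its centre, for a simple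
module `X`. -/
noncomputable def schurIndex : ℕ :=
  Nat.sqrt (Module.finrank (Subring.center (EndRing L G X)) (EndRing L G X))

variable [Module (baseField L G) X] [IsScalarTower (baseField L G) (TwistedGroupRing L G)ᵐᵒᵖ X]


variable {L G}
/-- For a central element `ξ` of `L ≀ G`, the operation `ξ ω^Z` of `ξ` on `X`, as an element of the
centre of the endomorphism ring of `X`. -/
noncomputable def centralAction
    (ξ : Subalgebra.center (baseField L G) (TwistedGroupRing L G)) :
    Subalgebra.center (baseField L G) (EndRing L G X) :=
  ⟨{ toFun := fun x => x <• (ξ : TwistedGroupRing L G)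
     map_add' := fun x y => smul_add _ x y
     map_smul' := fun a x => by
      have h := Subalgebra.mem_center_iff.1 ξ.2 a.unop
      rw [RingHom.id_apply, ← mul_smul, ← mul_smul]
      congr 1
      exact congrArg MulOpposite.op h },
    Subalgebra.mem_center_iff.2 fun φ => LinearMap.ext fun x => φ.map_smul _ x⟩

end

/-- `(X i)_i` is a complete set of nonisomorphic simple right `L ≀ G`-modules.  Since every simple
module is a quotient of the ring, it suffices to compare with modules in the universe of `L ≀ G`. -/
structure IsCompleteSimpleFamily (L : Type u) (G : Type v) [Field L] [Group G]
    [MulSemiringAction Gᵐᵒᵖ L] {ι : Type*} (X : ι → Type w) [∀ i, AddCommGroup (X i)]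
    [∀ i, Module (TwistedGroupRing L G)ᵐᵒᵖ (X i)] : Prop where
  simple : ∀ i, IsSimpleModule (TwistedGroupRing L G)ᵐᵒᵖ (X i)
  eq_of_equiv : ∀ i j, Nonempty (X i ≃ₗ[(TwistedGroupRing L G)ᵐᵒᵖ] X j) → i = j
  exists_equiv : ∀ (M : Type (max u v)) [AddCommGroup M] [Module (TwistedGroupRing L G)ᵐᵒᵖ M],
    IsSimpleModule (TwistedGroupRing L G)ᵐᵒᵖ M →
      ∃ i, Nonempty (M ≃ₗ[(TwistedGroupRing L G)ᵐᵒᵖ] X i)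

end TwistedGroupRing

/-! The form is `(ξ, ξ') ↦` coefficient of `1` in `ξ ξ'`. On orbit sums this coefficient is a sum of
conjugates over `C_G(ν)\G`, which a transitivity-of-trace argument identifies with the prescribed
value (`isCentralForm_centralForm`). Uniqueness holds because orbit sums span the centre
(`span_orbitSum`), and symmetry because the centre is commutative.

It remains to compute the coefficient of `1` in a central `ξ`. Since `n` is invertible, `L ≀ G` is
semisimple (`isSemisimpleModule`), so by the double centralizer theorem its centre is the product of
the fields `Z_i = Z(K_i)` (`centralActions_bijective`), with block idempotents `e_i`. Write `L N`
for the elements supported on `N`. Left multiplication by `ξ` preserves `L N` and has trace `n`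
times the coefficient of `1`, so it suffices to find the trace of `Z_i` on `e_i L N`.

Conjugation by `G` supplies, for every element of `Gal(L/K)`, a semilinear bijection of `e_i L N`
commuting with `Z_i`. As the Galois group permutes the maximal ideals of `L ⊗ Z_i` transitively,
`e_i L N` is free over `L ⊗ Z_i`, of some rank `r_i` (`exists_finrank_trace_eq`), and the trace of
`z` is `r_i Tr_{Z_i/K}(z)`.

The rank comes from a dimension count. The block `e_i (L ≀ G)` consists of `h = [G : N]` translates
of `e_i L N`, so its `K`-dimension is `h² r_i [Z_i : K]`; being `End_{K_i}(X_i)`, it also has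
dimension `x_i² d_i² [Z_i : K]`. Hence `h² r_i = (x_i d_i)²`, which yields both the divisibility and
`r_i = (x_i d_i / h)²` (`block_formula`). -/

section SemilinearFreeness

/-! ### Freeness over `L ⊗ Z` from semilinear symmetries. -/

open TensorProduct

/-- The action of the Galois group on the first factor of `L ⊗ Z`. -/
noncomputable abbrev galTensorAction (K L Z : Type*) [Field K] [Field L] [Algebra K L] [Field Z]
    [Algebra K Z] : MulSemiringAction (L ≃ₐ[K] L) (L ⊗[K] Z) where
  __ := (inferInstance : DistribMulAction (L ≃ₐ[K] L) (L ⊗[K] Z))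
  smul_one γ := by
    rw [Algebra.TensorProduct.one_def, TensorProduct.smul_tmul', smul_one]
  smul_mul γ a b := by
    induction a using TensorProduct.induction_on with
    | zero => simp
    | tmul x y =>
      induction b using TensorProduct.induction_on with
      | zero => simp
      | tmul x' y' => simp [TensorProduct.smul_tmul', Algebra.TensorProduct.tmul_mul_tmul]
      | add a b ha hb => simp only [mul_add, smul_add, ha, hb]
    | add a b ha hb => simp only [add_mul, smul_add, ha, hb]

/-- The Galois group of `L / K` permutes the maximal ideals of `L ⊗ Z` transitively. -/
theorem exists_map_tensor_eq (K L Z : Type*) [Field K] [Field L] [Algebra K L] [Field Z]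
    [Algebra K Z] [FiniteDimensional K L] [IsGalois K L] [FiniteDimensional K Z]
    (P Q : Ideal (L ⊗[K] Z)) [P.IsPrime] [Q.IsPrime] :
    ∃ γ : L ≃ₐ[K] L,
      Q = P.map (Algebra.TensorProduct.congr γ (AlgEquiv.refl : Z ≃ₐ[K] Z)).toRingEquiv := by
  let := galTensorAction K L Z
  let := Algebra.TensorProduct.rightAlgebra (R := K) (A := L) (B := Z)
  have hsm : ∀ (γ : L ≃ₐ[K] L) (b : L ⊗[K] Z),
      γ • b = Algebra.TensorProduct.map γ.toAlgHom (AlgHom.id K Z) b := fun γ b => by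
    induction b using TensorProduct.induction_on with
    | zero => simp
    | tmul x y => simp [TensorProduct.smul_tmul']
    | add a b ha hb => rw [smul_add, map_add, ha, hb]
  have hsmul : ∀ (z : Z) (b : L ⊗[K] Z), z • b = (1 ⊗ₜ z) * b := fun z b => Algebra.smul_def z b
  have : SMulCommClass (L ≃ₐ[K] L) Z (L ⊗[K] Z) := ⟨fun γ z b => by
    rw [hsmul, hsmul, hsm, hsm, map_mul]
    simp⟩
  -- Expanding an invariant `b` in a `K`-basis of `Z`, its coordinates in `L` are Galois-fixed,
  -- hence lie in `K`.
  have : Algebra.IsInvariant Z (L ⊗[K] Z) (L ≃ₐ[K] L) := ⟨fun b hb => by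
    let c := Module.finBasis K Z
    let C := Algebra.TensorProduct.basis L c
    have hCb : b = ∑ i, (C.repr b i) ⊗ₜ[K] (c i) := by
      conv_lhs => rw [← C.sum_repr b]
      refine Finset.sum_congr rfl fun i _ => ?_
      rw [Algebra.TensorProduct.basis_apply, TensorProduct.smul_tmul', smul_eq_mul, mul_one]
    have hrepr : ∀ (f : Fin (Module.finrank K Z) → L) i,
        C.repr (∑ i, (f i) ⊗ₜ[K] (c i)) i = f i := by
      intro f i
      have : ∑ i, (f i) ⊗ₜ[K] (c i) = ∑ i, f i • C i := by
        refine Finset.sum_congr rfl fun i _ => ?_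
        rw [Algebra.TensorProduct.basis_apply, TensorProduct.smul_tmul', smul_eq_mul, mul_one]
      rw [this, C.repr_sum_self]
    have hfix : ∀ i (γ : L ≃ₐ[K] L), γ (C.repr b i) = C.repr b i := by
      intro i γ
      have h := hb γ
      rw [hsm] at h
      conv_lhs at h => rw [hCb]
      simp only [map_sum, Algebra.TensorProduct.map_tmul] at h
      have := hrepr (fun i => γ (C.repr b i)) i
      rw [← this]
      conv_rhs => rw [← h]
      rfl
    have hk : ∀ i, ∃ k : K, algebraMap K L k = C.repr b i := fun i =>
      (IsGalois.mem_range_algebraMap_iff_fixed _).2 (hfix i)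
    choose k hk using hk
    refine ⟨∑ i, k i • c i, ?_⟩
    change (1 : L) ⊗ₜ[K] (∑ i, k i • c i) = b
    rw [TensorProduct.tmul_sum]
    conv_rhs => rw [hCb]
    refine Finset.sum_congr rfl fun i _ => ?_
    rw [TensorProduct.tmul_smul, TensorProduct.smul_tmul', ← hk, Algebra.smul_def, mul_one]⟩
  -- `Z` is a field, so all primes lie over the same prime, and transitivity on fibres gives
  -- transitivity outright.
  have hne : ∀ I : Ideal (L ⊗[K] Z), I.IsPrime → I.under Z = ⊥ := fun I hI => by
    refine (Ideal.eq_bot_or_top _).resolve_right fun h => hI.ne_top ?_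
    rw [Ideal.eq_top_iff_one] at h ⊢
    rw [Ideal.under_def, Ideal.mem_comap, map_one] at h
    exact h
  obtain ⟨γ, hγ⟩ := Algebra.IsInvariant.exists_smul_of_under_eq Z (L ⊗[K] Z) (L ≃ₐ[K] L) P Q
    ((hne P inferInstance).trans (hne Q inferInstance).symm)
  refine ⟨γ, hγ.trans ?_⟩
  rw [Ideal.pointwise_smul_def]
  change P.map _ = P.map _
  congr 1

/-- `L / K` is separable, and unramified algebras over the field `Z` are reduced. Being also
Artinian, `L ⊗ Z` is semisimple, so all its modules are projective. -/
theorem isReduced_tensor (K L Z : Type*) [Field K] [Field L] [Algebra K L] [Field Z]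
    [Algebra K Z] [FiniteDimensional K L] [IsGalois K L] : IsReduced (L ⊗[K] Z) := by
  have : Algebra.FormallyUnramified K L := Algebra.FormallyUnramified.of_isSeparable K L
  have : IsReduced (Z ⊗[K] L) := Algebra.FormallyUnramified.isReduced_of_field Z _
  exact isReduced_of_injective (Algebra.TensorProduct.comm K L Z)
    (Algebra.TensorProduct.comm K L Z).injective

/-- The semilinear bijection `φ` carries `P V` onto `Q V` and so induces `V / P V ≃ V / Q V` over `B
/ P ≃ B / Q`. Fibre ranks are thus constant along Galois orbits. -/
theorem finrank_quotient_tensor_eq {B V : Type*} [CommRing B] [AddCommGroup V] [Module B V]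
    (P Q : Ideal B) (f : B ≃+* B) (φ : V ≃+ V) (hφ : ∀ b v, φ (b • v) = f b • φ v)
    (hQ : Q = P.map f) :
    Module.finrank (B ⧸ P) ((B ⧸ P) ⊗[B] V) = Module.finrank (B ⧸ Q) ((B ⧸ Q) ⊗[B] V) := by
  have key : ∀ I : Ideal B, Module.finrank (B ⧸ I) ((B ⧸ I) ⊗[B] V) =
      Module.finrank (B ⧸ I) (V ⧸ (I • ⊤ : Submodule B V)) := fun I =>
    (LinearEquiv.extendScalarsOfSurjective (S := B ⧸ I) Ideal.Quotient.mk_surjective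
      (TensorProduct.quotTensorEquivQuotSMul V I)).finrank_eq
  rw [key, key]
  let : RingHomInvPair (f : B →+* B) (f.symm : B →+* B) := RingHomInvPair.of_ringEquiv f
  let : RingHomInvPair (f.symm : B →+* B) (f : B →+* B) := RingHomInvPair.symm _ _
  let ψ : V ≃ₛₗ[(f : B →+* B)] V := { φ with map_smul' := hφ }
  have hmap : (P • ⊤ : Submodule B V).map (ψ : V →ₛₗ[(f : B →+* B)] V) =
      (Q • ⊤ : Submodule B V) := by
    apply le_antisymm
    · rw [Submodule.map_le_iff_le_comap, Submodule.smul_le]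
      intro p hp v _
      rw [Submodule.mem_comap]
      change φ (p • v) ∈ _
      rw [hφ]
      refine Submodule.smul_mem_smul ?_ trivial
      rw [hQ]
      exact Ideal.mem_map_of_mem _ hp
    · rw [Submodule.smul_le]
      intro q hq v _
      rw [hQ] at hq
      obtain ⟨p, hp, rfl⟩ := (Ideal.mem_map_of_equiv f q).1 hq
      refine ⟨p • φ.symm v, Submodule.smul_mem_smul hp trivial, ?_⟩
      change φ (p • φ.symm v) = _
      rw [hφ, AddEquiv.apply_symm_apply]
  let e := Submodule.Quotient.equiv _ _ ψ hmap
  refine congrArg Cardinal.toNat (rank_eq_of_equiv_equiv (Ideal.quotientEquiv P Q f hQ) e.toAddEquiv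
    (Ideal.quotientEquiv P Q f hQ).bijective ?_)
  rintro ⟨b⟩ ⟨v⟩
  exact congrArg (Submodule.Quotient.mk (p := (Q • ⊤ : Submodule B V))) (hφ b v)

/-- If a finite-dimensional `L`-space `V` carries a commuting action of a finite extension `Z` of `K`
and every element of the Galois group of `L / K` has a `Z`-linear semilinear bijection of `V`, then
`V` is free over `L ⊗ Z`.  We record its dimension and the trace of the action of `Z`. -/
theorem exists_finrank_trace_eq (K L Z V : Type*) [Field K] [Field L] [Algebra K L]
    [FiniteDimensional K L] [IsGalois K L] [Field Z] [Algebra K Z] [FiniteDimensional K Z]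
    [AddCommGroup V] [Module K V] [Module L V] [IsScalarTower K L V] [FiniteDimensional L V]
    (ρ : Z →ₐ[K] Module.End L V)
    (hρ : ∀ γ : L ≃ₐ[K] L, ∃ φ : V ≃+ V, (∀ (y : L) v, φ (y • v) = γ y • φ v) ∧
      ∀ z v, φ (ρ z v) = ρ z (φ v)) :
    ∃ r : ℕ, Module.finrank L V = r * Module.finrank K Z ∧
      ∀ z, LinearMap.trace L V (ρ z) = (r : L) * algebraMap K L (Algebra.trace K Z z) := by
  let : Module Z V := Module.compHom V (ρ : Z →+* Module.End L V)
  have hz : ∀ (z : Z) (v : V), z • v = ρ z v := fun _ _ => rfl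
  have : IsScalarTower K Z V := ⟨fun k z v => by
    rw [hz, hz, map_smul, LinearMap.smul_apply]⟩
  have : SMulCommClass L Z V := ⟨fun y z v => by rw [hz, hz, map_smul]⟩
  let : Module (L ⊗[K] Z) V := TensorProduct.Algebra.module
  have ht : ∀ (y : L) (z : Z) (v : V), (y ⊗ₜ[K] z) • v = y • ρ z v :=
    fun y z v => TensorProduct.Algebra.smul_def y z v
  have : IsScalarTower L (L ⊗[K] Z) V := ⟨fun y b v => by
    induction b using TensorProduct.induction_on with
    | zero => simp
    | tmul x z => rw [TensorProduct.smul_tmul', ht, ht, smul_assoc]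
    | add a b ha hb => rw [smul_add, add_smul, add_smul, smul_add, ha, hb]⟩
  have : Module.Finite (L ⊗[K] Z) V := Module.Finite.of_restrictScalars_finite L _ _
  have := isReduced_tensor K L Z
  have : IsArtinianRing (L ⊗[K] Z) := IsArtinianRing.of_finite L _
  have : IsSemisimpleRing (L ⊗[K] Z) := IsArtinianRing.isSemisimpleRing_of_isReduced _
  have : Module.Projective (L ⊗[K] Z) V := Module.projective_of_isSemisimpleRing _ _
  obtain ⟨P₀, hP₀⟩ := Ideal.exists_maximal (L ⊗[K] Z)
  -- A projective module can have different ranks at different maximal ideals; transitivity compares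
  -- each of them with `P₀`.
  have : Module.Free (L ⊗[K] Z) V := by
    refine Module.free_of_flat_of_finrank_eq (L ⊗[K] Z) V
      (Module.finrank ((L ⊗[K] Z) ⧸ P₀) (((L ⊗[K] Z) ⧸ P₀) ⊗[L ⊗[K] Z] V)) fun P => ?_
    have := P.2
    obtain ⟨γ, hγ⟩ := exists_map_tensor_eq K L Z P₀ P.1
    obtain ⟨φ, h1, h2⟩ := hρ γ
    refine (finrank_quotient_tensor_eq P₀ P.1 _ φ ?_ hγ).symm
    intro b v
    induction b using TensorProduct.induction_on with
    | zero => simp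
    | tmul x z =>
      rw [ht, h1, h2]
      exact (ht _ _ _).symm
    | add a b ha hb => rw [add_smul, map_add, ha, hb, map_add, add_smul]
  let b := Module.finBasis (L ⊗[K] Z) V
  let c := Algebra.TensorProduct.basis L (Module.finBasis K Z)
  refine ⟨Module.finrank (L ⊗[K] Z) V, ?_, fun z => ?_⟩
  · rw [← Module.finrank_mul_finrank L (L ⊗[K] Z) V, Module.finrank_eq_card_basis c,
      Fintype.card_fin, mul_comm]
  · have h1 : LinearMap.trace L V (ρ z) = LinearMap.trace L V
        (Algebra.lsmul L L V ((1 : L) ⊗ₜ[K] z)) := by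
      congr 1
      ext v
      simp [ht]
    -- Multiplication by `1 ⊗ z` is the base change to `L` of multiplication by `z` on `Z`.
    have h2 : LinearMap.trace L (L ⊗[K] Z) (Algebra.lmul L (L ⊗[K] Z) ((1 : L) ⊗ₜ[K] z)) =
        algebraMap K L (Algebra.trace K Z z) := by
      rw [Algebra.trace_apply, ← LinearMap.trace_baseChange]
      congr 1
      ext w
      simp
    let e : V ≃ₗ[L] (Fin (Module.finrank (L ⊗[K] Z) V) → (L ⊗[K] Z)) :=
      b.equivFun.restrictScalars L
    rw [h1, ← LinearMap.trace_conj' _ e, ← h2]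
    -- In coordinates the operator is block diagonal, with equal blocks.
    have h3 : e.conj (Algebra.lsmul L L V ((1 : L) ⊗ₜ[K] z)) =
        ∑ i, LinearMap.single L (fun _ => L ⊗[K] Z) i ∘ₗ
          (Algebra.lmul L (L ⊗[K] Z) ((1 : L) ⊗ₜ[K] z)) ∘ₗ LinearMap.proj i := by
      refine LinearMap.ext fun w => ?_
      rw [LinearEquiv.conj_apply_apply]
      funext j
      have : e ((Algebra.lsmul L L V ((1 : L) ⊗ₜ[K] z)) (e.symm w)) =
          ((1 : L) ⊗ₜ[K] z : L ⊗[K] Z) • w := by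
        change b.equivFun (((1 : L) ⊗ₜ[K] z : L ⊗[K] Z) • b.equivFun.symm w) = _
        rw [map_smul, LinearEquiv.apply_symm_apply]
      rw [this]
      simp [Finset.sum_apply, Pi.single_apply]
    rw [h3, map_sum]
    have h4 : ∀ i : Fin (Module.finrank (L ⊗[K] Z) V), LinearMap.trace L _
        (LinearMap.single L (fun _ => L ⊗[K] Z) i ∘ₗ
          (Algebra.lmul L (L ⊗[K] Z) ((1 : L) ⊗ₜ[K] z)) ∘ₗ LinearMap.proj i) =
        LinearMap.trace L (L ⊗[K] Z) (Algebra.lmul L (L ⊗[K] Z) ((1 : L) ⊗ₜ[K] z)) := by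
      intro i
      rw [LinearMap.trace_comp_comm', LinearMap.comp_assoc]
      congr 1
      ext w
      simp
    rw [Finset.sum_congr rfl fun i _ => h4 i]
    simp

end SemilinearFreeness

/-! ### Degrees of central division algebras. -/

section CentralSimple

open TensorProduct

/-- The bimultiplications of a division algebra `D` over its centre exhaust the linear
endomorphisms. -/
theorem mulLeftRight_surjective (Z D : Type*) [Field Z] [DivisionRing D] [Algebra Z D]
    [Algebra.IsCentral Z D] [FiniteDimensional Z D] :
    Function.Surjective (AlgHom.mulLeftRight Z D) := by
  let A := D ⊗[Z] Dᵐᵒᵖ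
  let : Module A D := Module.compHom D (AlgHom.mulLeftRight Z D : A →+* Module.End Z D)
  have hsm : ∀ (a : A) (x : D), a • x = AlgHom.mulLeftRight Z D a x := fun _ _ => rfl
  have ht : ∀ (a : D) (b : Dᵐᵒᵖ) (x : D), ((a ⊗ₜ[Z] b : A)) • x = a * x * b.unop :=
    fun a b x => by rw [hsm, AlgHom.mulLeftRight_apply]
  have : IsSimpleModule A D := by
    rw [isSimpleModule_iff_toSpanSingleton_surjective]
    refine ⟨inferInstance, fun x hx y => ⟨((y * x⁻¹) ⊗ₜ[Z] 1 : A), ?_⟩⟩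
    rw [LinearMap.toSpanSingleton_apply, ht]
    simp [hx]
  -- The commutant of the bimultiplications is just `Z`, so every `Z`-linear map falls under
  -- Jacobson density.
  have hend : ∀ g : Module.End A D, ∃ z : Z, ∀ x, g x = z • x := by
    intro g
    have hl : ∀ a x : D, g (a * x) = a * g x := fun a x => by
      have := g.map_smul ((a ⊗ₜ[Z] 1 : A)) x
      rw [ht, ht] at this
      simpa using this
    have hr : ∀ a x : D, g (x * a) = g x * a := fun a x => by
      have := g.map_smul (((1 : D) ⊗ₜ[Z] MulOpposite.op a : A)) x
      rw [ht, ht] at this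
      simpa using this
    have hc : g 1 ∈ Subalgebra.center Z D := by
      rw [Subalgebra.mem_center_iff]
      intro b
      rw [← hl, ← hr, mul_one, one_mul]
    obtain ⟨z, hz⟩ := Algebra.mem_bot.1 (Algebra.IsCentral.out hc)
    refine ⟨z, fun x => ?_⟩
    rw [← one_mul x, hr, ← hz, one_mul, Algebra.smul_def]
  intro f
  let F : Module.End (Module.End A D) D :=
    { toFun := f
      map_add' := f.map_add
      map_smul' := fun g x => by
        obtain ⟨z, hz⟩ := hend g
        rw [Module.End.smul_def, hz, map_smul, RingHom.id_apply, Module.End.smul_def, hz] }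
  let b := Module.finBasis Z D
  classical
  obtain ⟨a, ha⟩ := jacobson_density F (Finset.univ.image b)
  refine ⟨a, b.ext fun i => ?_⟩
  rw [← hsm, ← ha (b i) (by simp)]
  rfl

/-- A two-sided ideal is stable under bimultiplications by `D`, hence under the base change of all
of `End_Z D`. Projecting a nonzero element to one coordinate then puts a nonzero scalar of `E` into
the ideal. -/
theorem isSimpleRing_tensor (Z D E : Type*) [Field Z] [DivisionRing D] [Algebra Z D]
    [Algebra.IsCentral Z D] [FiniteDimensional Z D] [Field E] [Algebra Z E] :
    IsSimpleRing (E ⊗[Z] D) := by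
  refine ⟨⟨fun I => ?_⟩⟩
  rw [or_iff_not_imp_left]
  intro hI
  obtain ⟨x, hxI, hx0⟩ : ∃ x ∈ I, x ≠ 0 := by
    by_contra! h
    exact hI (le_antisymm (fun x hx => by rw [h x hx]; exact TwoSidedIdeal.zero_mem _) bot_le)
  have hstab : ∀ f : Module.End Z D, ∀ y ∈ I, f.baseChange E y ∈ I := by
    intro f y hy
    obtain ⟨a, rfl⟩ := mulLeftRight_surjective Z D f
    induction a using TensorProduct.induction_on with
    | zero => simp
    | tmul c d =>
      have : ∀ y : E ⊗[Z] D, (AlgHom.mulLeftRight Z D (c ⊗ₜ[Z] d)).baseChange E y =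
          (1 ⊗ₜ[Z] c) * y * (1 ⊗ₜ[Z] d.unop) := by
        intro y
        induction y using TensorProduct.induction_on with
        | zero => simp
        | tmul u v => simp [AlgHom.mulLeftRight_apply]
        | add u v hu hv => rw [map_add, hu, hv, mul_add, add_mul]
      rw [this]
      exact I.mul_mem_right _ _ (I.mul_mem_left _ _ hy)
    | add a b ha hb =>
      rw [map_add, LinearMap.baseChange_add, LinearMap.add_apply]
      exact I.add_mem ha hb
  let b := Module.finBasis Z D
  let B := Algebra.TensorProduct.basis E b
  obtain ⟨i, hi⟩ : ∃ i, B.repr x i ≠ 0 := by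
    by_contra! h
    exact hx0 (B.ext_elem fun i => by simp [h])
  let f : Module.End Z D := (LinearMap.toSpanSingleton Z D 1) ∘ₗ b.coord i
  have hf : f.baseChange E x = (B.repr x i) ⊗ₜ 1 := by
    conv_lhs => rw [← B.sum_repr x]
    rw [map_sum, Finset.sum_eq_single i]
    · rw [map_smul, Algebra.TensorProduct.basis_apply, LinearMap.baseChange_tmul]
      simp [f, TensorProduct.smul_tmul']
    · intro j _ hj
      rw [map_smul, Algebra.TensorProduct.basis_apply, LinearMap.baseChange_tmul]
      simp [f, hj]
    · simp
  have h1 : (1 : E ⊗[Z] D) ∈ I := by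
    have h2 := I.mul_mem_left ((B.repr x i)⁻¹ ⊗ₜ 1) _ (hf ▸ hstab f x hxI)
    rwa [Algebra.TensorProduct.tmul_mul_tmul, inv_mul_cancel₀ hi, one_mul] at h2
  exact eq_top_iff.2 fun y _ => by simpa using I.mul_mem_left y 1 h1

/-- The degree of a finite-dimensional central division algebra is a perfect square. -/
theorem isSquare_finrank (Z D : Type*) [Field Z] [DivisionRing D] [Algebra Z D]
    [Algebra.IsCentral Z D] [FiniteDimensional Z D] : IsSquare (Module.finrank Z D) := by
  -- Over the algebraic closure a simple algebra is a full `n × n` matrix ring, of dimension `n *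
  -- n`.
  let E := AlgebraicClosure Z
  have := isSimpleRing_tensor Z D E
  obtain ⟨n, -, ⟨e⟩⟩ := IsSimpleRing.exists_algEquiv_matrix_of_isAlgClosed E (E ⊗[Z] D)
  refine ⟨n, ?_⟩
  rw [← Module.finrank_baseChange (R := E), e.toLinearEquiv.finrank_eq, Module.finrank_matrix]
  simp

theorem sqrt_finrank_center_sq (D : Type*) [DivisionRing D] :
    Nat.sqrt (Module.finrank (Subring.center D) D) ^ 2 = Module.finrank (Subring.center D) D := by
  by_cases h : Module.Finite (Subring.center D) D
  · have : Algebra.IsCentral (Subring.center D) D := ⟨fun x hx => by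
      rw [Subalgebra.mem_center_iff] at hx
      exact Algebra.mem_bot.2 ⟨⟨x, Subring.mem_center_iff.2 hx⟩, rfl⟩⟩
    obtain ⟨r, hr⟩ := isSquare_finrank (Subring.center D) D
    rw [hr, Nat.sqrt_eq, sq]
  -- In infinite degree `finrank` is `0` by convention, which is its own square root.
  · rw [Module.finrank_of_not_finite h]
    rfl

end CentralSimple

/-! ### Sums over a group acting on a field, in terms of traces. -/

section GroupSums

theorem sum_comp_monoidHom {H Q M : Type*} [Group H] [Group Q] [Fintype H] [Fintype Q]
    [AddCommMonoid M] (f : H →* Q) (hf : Function.Surjective f) (F : Q → M) :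
    ∑ h, F (f h) = Nat.card f.ker • ∑ q, F q := by
  classical
  rw [← Finset.sum_fiberwise (s := Finset.univ) (g := f), Finset.smul_sum]
  refine Finset.sum_congr rfl fun q _ => ?_
  rw [Finset.sum_congr rfl (g := fun _ => F q) (by
    intro h hh
    rw [(Finset.mem_filter.1 hh).2]), Finset.sum_const]
  congr 1
  obtain ⟨h₀, rfl⟩ := hf q
  rw [← Fintype.card_subtype, ← Nat.card_eq_fintype_card]
  exact Nat.card_congr
    { toFun := fun h => ⟨h₀⁻¹ * h.1, by rw [MonoidHom.mem_ker, map_mul, h.2, map_inv, inv_mul_cancel]⟩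
      invFun := fun k => ⟨h₀ * k.1, by rw [map_mul, k.2, mul_one]⟩
      left_inv := fun h => by simp
      right_inv := fun k => by simp }

variable (H F L : Type*) [Group H] [Finite H] [Field F] [Field L] [Algebra F L]
  [MulSemiringAction H L] [SMulCommClass H F L] [Algebra.IsInvariant F L H]

/-- Every invariant of `H` comes from `F`, so an `F`-automorphism fixes the fixed field of `H` and
Artin's theorem applies. -/
theorem toAlgAut_surjective_of_isInvariant :
    Function.Surjective (MulSemiringAction.toAlgAut H F L) := by
  intro γ
  obtain ⟨h, hh⟩ := FixedPoints.toAlgAut_surjective H L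
    (AlgEquiv.ofRingEquiv (f := γ.toRingEquiv) fun x => by
      obtain ⟨a, ha⟩ := Algebra.IsInvariant.isInvariant (A := F) (x : L) (fun g => x.2 g)
      change γ (x : L) = x
      rw [← ha, γ.commutes])
  refine ⟨h, AlgEquiv.ext fun x => ?_⟩
  exact DFunLike.congr_fun hh x

/-- Each Galois automorphism is induced by as many elements of `H` as the kernel has. -/
theorem sum_smul_eq_card_mul_trace [Fintype H] [FiniteDimensional F L] [IsGalois F L] (y : L) :
    ∑ h : H, h • y = (Nat.card (MulSemiringAction.toAlgAut H F L).ker : L) *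
      algebraMap F L (Algebra.trace F L y) := by
  rw [trace_eq_sum_automorphisms, ← nsmul_eq_mul,
    ← sum_comp_monoidHom _ (toAlgAut_surjective_of_isInvariant H F L) (fun γ => γ y)]
  rfl

theorem card_eq_card_ker_mul_finrank [FiniteDimensional F L] [IsGalois F L] :
    Nat.card H = Nat.card (MulSemiringAction.toAlgAut H F L).ker * Module.finrank F L := by
  cases nonempty_fintype H
  have := sum_comp_monoidHom _ (toAlgAut_surjective_of_isInvariant H F L) (fun _ => 1)
  rw [Finset.sum_const, Finset.sum_const, Finset.card_univ, Finset.card_univ] at this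
  rw [← IsGalois.card_aut_eq_finrank, Nat.card_eq_fintype_card (α := H),
    Nat.card_eq_fintype_card (α := L ≃ₐ[F] L)]
  simpa only [smul_eq_mul, mul_one] using this

end GroupSums

namespace TwistedGroupRing

/-! ### Coefficients, and the centre described through them. -/

section Coefficients

variable {L G : Type*} [Field L] [Group G] [MulSemiringAction Gᵐᵒᵖ L]

/-- The coefficient of `σ` in an element of `L ≀ G`. -/
noncomputable def coeff (ξ : TwistedGroupRing L G) (σ : G) : L :=
  SkewMonoidAlgebra.coeff (MulOpposite.unop ξ) (MulOpposite.op σ)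

theorem coeff_single [DecidableEq G] (σ τ : G) (y : L) :
    coeff (single σ y) τ = if σ = τ then y else 0 := by
  classical
  change SkewMonoidAlgebra.coeff (SkewMonoidAlgebra.single (MulOpposite.op σ) y)
    (MulOpposite.op τ) = _
  rw [SkewMonoidAlgebra.coeff_single_apply]
  simp

theorem coeff_single_same (σ : G) (y : L) : coeff (single σ y) σ = y := by
  classical
  rw [coeff_single, if_pos rfl]

theorem coeff_add (ξ η : TwistedGroupRing L G) (σ : G) :
    coeff (ξ + η) σ = coeff ξ σ + coeff η σ :=
  DFunLike.congr_fun (SkewMonoidAlgebra.coeff_add _ _) _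

theorem coeff_smul (c : baseField L G) (ξ : TwistedGroupRing L G) (σ : G) :
    coeff (c • ξ) σ = c • coeff ξ σ := rfl

theorem coeff_zero (σ : G) : coeff (0 : TwistedGroupRing L G) σ = 0 := rfl

theorem ext_coeff {ξ η : TwistedGroupRing L G} (h : ∀ σ, coeff ξ σ = coeff η σ) : ξ = η :=
  MulOpposite.unop_injective (SkewMonoidAlgebra.ext fun σ => h σ.unop)

theorem single_add (σ : G) (y z : L) : single σ (y + z) = single σ y + single σ z := by
  classical
  refine ext_coeff fun τ => ?_
  rw [coeff_add, coeff_single, coeff_single, coeff_single]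
  split_ifs <;> simp

theorem single_zero (σ : G) : single σ (0 : L) = 0 := by
  classical
  refine ext_coeff fun τ => ?_
  rw [coeff_single, coeff_zero]
  split_ifs <;> rfl

variable (L G) in
/-- The coordinates of an element of `L ≀ G`. -/
noncomputable def coeffEquiv [Finite G] : TwistedGroupRing L G ≃ₗ[baseField L G] (G → L) where
  toFun := coeff
  map_add' ξ η := funext fun σ => coeff_add ξ η σ
  map_smul' c ξ := funext fun σ => coeff_smul c ξ σ
  invFun f := MulOpposite.op
    ⟨have := Finite.of_equiv G MulOpposite.opEquiv; Finsupp.equivFunOnFinite.symm fun σ : Gᵐᵒᵖ => f σ.unop⟩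
  left_inv _ := ext_coeff fun _ => rfl
  right_inv _ := rfl

theorem coeffEquiv_apply [Finite G] (ξ : TwistedGroupRing L G) (σ : G) :
    coeffEquiv L G ξ σ = coeff ξ σ := rfl

theorem coeff_coeffEquiv_symm [Finite G] (f : G → L) (σ : G) :
    coeff ((coeffEquiv L G).symm f) σ = f σ := rfl

theorem coeff_sum [Finite G] {α : Type*} (s : Finset α) (f : α → TwistedGroupRing L G) (σ : G) :
    coeff (∑ a ∈ s, f a) σ = ∑ a ∈ s, coeff (f a) σ := by
  rw [← coeffEquiv_apply, map_sum, Finset.sum_apply]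
  rfl

theorem smul_mul_op (y : L) (σ τ : G) : y <• (σ * τ) = y <• σ <• τ := by
  rw [MulOpposite.op_mul, mul_smul]

theorem coeff_single_mul (σ τ : G) (y : L) (ξ : TwistedGroupRing L G) :
    coeff (single σ y * ξ) τ = (y <• (σ⁻¹ * τ)) * coeff ξ (σ⁻¹ * τ) := by
  classical
  induction ξ using induction_single with
  | hs ρ z =>
    rw [single_mul_single, coeff_single, coeff_single]
    by_cases h : σ * ρ = τ
    · subst h
      simp
    · rw [if_neg h, if_neg (fun h' => h (by rw [h']; simp)), mul_zero]
  | ha ξ η hξ hη => rw [mul_add, coeff_add, hξ, hη, coeff_add, mul_add]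

theorem coeff_mul_single (σ τ : G) (z : L) (ξ : TwistedGroupRing L G) :
    coeff (ξ * single τ z) σ = (coeff ξ (σ * τ⁻¹) <• τ) * z := by
  classical
  induction ξ using induction_single with
  | hs ρ y =>
    rw [single_mul_single, coeff_single, coeff_single]
    by_cases h : ρ * τ = σ
    · subst h
      simp
    · rw [if_neg h, if_neg (fun h' => h (by rw [h']; simp)), smul_zero, zero_mul]
  | ha ξ η hξ hη => rw [add_mul, coeff_add, hξ, hη, coeff_add, smul_add, add_mul]

/-- Commuting with the scalars `single 1 y` forces the support into `N`; commuting with `single τ 1`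
is equivariance under conjugation. Together these elements generate the ring. -/
theorem mem_center_iff {ξ : TwistedGroupRing L G} :
    ξ ∈ Subalgebra.center (baseField L G) (TwistedGroupRing L G) ↔
      (∀ σ ∉ kernel L G, coeff ξ σ = 0) ∧
        ∀ σ τ, coeff ξ (τ⁻¹ * σ * τ) = coeff ξ σ <• τ := by
  rw [Subalgebra.mem_center_iff]
  constructor
  · intro h
    constructor
    · intro σ hσ
      rw [mem_kernel] at hσ
      push Not at hσ
      obtain ⟨y, hy⟩ := hσ
      have := congrArg (fun η => coeff η σ) (h (single 1 y))
      simp only [coeff_single_mul, coeff_mul_single, inv_one, one_mul, mul_one, MulOpposite.op_one,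
        one_smul] at this
      rw [mul_comm, ← sub_eq_zero, ← mul_sub] at this
      exact (mul_eq_zero.1 this).resolve_right (sub_ne_zero.2 hy)
    · intro σ τ
      have := congrArg (fun η => coeff η (σ * τ)) (h (single τ 1))
      simpa [coeff_single_mul, coeff_mul_single, mul_assoc] using this
  · rintro ⟨h1, h2⟩ b
    induction b using induction_single with
    | hs τ z =>
      refine ext_coeff fun σ => ?_
      rw [coeff_single_mul, coeff_mul_single]
      have h3 : coeff ξ (τ⁻¹ * σ) = coeff ξ (σ * τ⁻¹) <• τ := by
        rw [← h2]
        congr 1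
        group
      rw [← h3]
      by_cases hk : τ⁻¹ * σ ∈ kernel L G
      · rw [mem_kernel.1 hk, mul_comm]
      · rw [h1 _ hk, mul_zero, zero_mul]
    | ha ξ η hξ hη => rw [add_mul, mul_add, hξ, hη]

end Coefficients

/-! ### Orbit sums span the centre. -/

section OrbitSums

variable {L G : Type*} [Field L] [Group G] [MulSemiringAction Gᵐᵒᵖ L]

theorem coeff_mem_centralizerField
    (ξ : Subalgebra.center (baseField L G) (TwistedGroupRing L G)) (σ : G) :
    coeff (ξ : TwistedGroupRing L G) σ ∈ centralizerField L σ := by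
  rw [mem_centralizerField]
  intro ρ hρ
  rw [← (mem_center_iff.1 ξ.2).2]
  congr 1
  rw [mul_assoc, hρ, inv_mul_cancel_left]

theorem coeff_one_mem_baseField
    (ξ : Subalgebra.center (baseField L G) (TwistedGroupRing L G)) :
    coeff (ξ : TwistedGroupRing L G) 1 ∈ baseField L G := by
  intro ρ
  have := (mem_center_iff.1 ξ.2).2 1 ρ.unop
  rw [mul_one, inv_mul_cancel] at this
  exact this.symm

variable [Finite G]

theorem coeff_orbitSum_conj (ν : kernel L G) (y : centralizerField L (ν : G)) (τ : G) :
    coeff (orbitSum ν y : TwistedGroupRing L G) (τ⁻¹ * ν * τ) = (y : L) <• τ := by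
  classical
  cases nonempty_fintype G
  rw [(mem_center_iff.1 (orbitSum ν y).2).2]
  congr 1
  change coeff (orbitSumAux (ν : G) y) ν = y
  have := Fintype.ofFinite (Quotient (QuotientGroup.rightRel (Subgroup.centralizer {(ν : G)})))
  rw [orbitSumAux, finsum_eq_sum_of_fintype, coeff_sum,
    Finset.sum_eq_single (Quotient.mk _ (1 : G))]
  · change coeff (single (1⁻¹ * (ν : G) * 1) ((y : L) <• (1 : G))) ν = y
    simp [coeff_single_same]
  · intro q _ hq
    induction q using Quotient.inductionOn with
    | h ρ =>
      change coeff (single (ρ⁻¹ * (ν : G) * ρ) ((y : L) <• ρ)) ν = 0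
      rw [coeff_single, if_neg]
      intro h
      refine hq (Quotient.sound ?_)
      change QuotientGroup.rightRel _ ρ 1
      rw [QuotientGroup.rightRel_apply, Subgroup.mem_centralizer_singleton_iff]
      rw [one_mul, eq_mul_inv_iff_mul_eq, h]
  · simp

theorem coeff_orbitSum_of_not_isConj (ν : kernel L G) (y : centralizerField L (ν : G)) (σ : G)
    (h : ¬ IsConj (ν : G) σ) : coeff (orbitSum ν y : TwistedGroupRing L G) σ = 0 := by
  classical
  change coeff (orbitSumAux (ν : G) y) σ = 0
  have := Fintype.ofFinite (Quotient (QuotientGroup.rightRel (Subgroup.centralizer {(ν : G)})))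
  rw [orbitSumAux, finsum_eq_sum_of_fintype, coeff_sum]
  refine Finset.sum_eq_zero fun q _ => ?_
  induction q using Quotient.inductionOn with
  | h ρ =>
    change coeff (single (ρ⁻¹ * (ν : G) * ρ) ((y : L) <• ρ)) σ = 0
    rw [coeff_single, if_neg]
    rintro rfl
    exact h (isConj_iff.2 ⟨ρ⁻¹, by group⟩)

/-- The orbit sums span the centre of `L ≀ G`. -/
theorem span_orbitSum : Submodule.span (baseField L G)
    {ξ : Subalgebra.center (baseField L G) (TwistedGroupRing L G) |
      ∃ (ν : kernel L G) (y : centralizerField L (ν : G)), ξ = orbitSum ν y} = ⊤ := by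
  classical
  cases nonempty_fintype G
  rw [eq_top_iff]
  -- Induction on the size of the support: subtracting the orbit sum of one nonzero term clears its
  -- conjugacy class and leaves the other coefficients unchanged.
  suffices h : ∀ (m : ℕ) (ξ : Subalgebra.center (baseField L G) (TwistedGroupRing L G)),
      (Finset.univ.filter fun σ => coeff (ξ : TwistedGroupRing L G) σ ≠ 0).card ≤ m →
      ξ ∈ Submodule.span (baseField L G)
        {ξ : Subalgebra.center (baseField L G) (TwistedGroupRing L G) |
          ∃ (ν : kernel L G) (y : centralizerField L (ν : G)), ξ = orbitSum ν y} from
    fun ξ _ => h _ ξ le_rfl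
  intro m
  induction m with
  | zero =>
    intro ξ hξ
    have : ξ = 0 := by
      refine Subtype.ext (ext_coeff fun σ => ?_)
      by_contra hne
      have := Finset.card_eq_zero.1 (Nat.le_zero.1 hξ)
      exact Finset.notMem_empty σ (this ▸ Finset.mem_filter.2 ⟨Finset.mem_univ σ, hne⟩)
    rw [this]
    exact Submodule.zero_mem _
  | succ m ih =>
    intro ξ hξ
    by_cases h0 : ∃ σ, coeff (ξ : TwistedGroupRing L G) σ ≠ 0
    · obtain ⟨σ, hσ⟩ := h0
      have hk : σ ∈ kernel L G := by
        by_contra hk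
        exact hσ ((mem_center_iff.1 ξ.2).1 σ hk)
      let η := orbitSum (⟨σ, hk⟩ : kernel L G) ⟨_, coeff_mem_centralizerField ξ σ⟩
      have hη : ∀ τ, IsConj σ τ → coeff (η : TwistedGroupRing L G) τ =
          coeff (ξ : TwistedGroupRing L G) τ := by
        intro τ hτ
        obtain ⟨c, rfl⟩ := isConj_iff.1 hτ
        have h1 := coeff_orbitSum_conj (⟨σ, hk⟩ : kernel L G) ⟨_, coeff_mem_centralizerField ξ σ⟩ c⁻¹
        have h2 := (mem_center_iff.1 ξ.2).2 σ c⁻¹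
        rw [inv_inv] at h1 h2
        exact h1.trans h2.symm
      have hη' : ∀ τ, ¬ IsConj σ τ → coeff (η : TwistedGroupRing L G) τ = 0 := fun τ hτ =>
        coeff_orbitSum_of_not_isConj _ _ τ hτ
      have hsub : ∀ τ, coeff ((ξ - η : Subalgebra.center (baseField L G) (TwistedGroupRing L G)) :
          TwistedGroupRing L G) τ =
          coeff (ξ : TwistedGroupRing L G) τ - coeff (η : TwistedGroupRing L G) τ := fun τ => by
        rw [eq_sub_iff_add_eq, ← coeff_add]
        congr 1
        simp
      have hmem := ih (ξ - η) (by
        refine Nat.le_of_lt_succ (lt_of_lt_of_le (Finset.card_lt_card ?_) hξ)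
        refine Finset.ssubset_iff_of_subset (fun τ hτ => ?_) |>.2 ⟨σ, ?_, ?_⟩
        · rw [Finset.mem_filter, hsub] at hτ
          rw [Finset.mem_filter]
          refine ⟨Finset.mem_univ _, fun h => hτ.2 ?_⟩
          by_cases hc : IsConj σ τ
          · rw [hη τ hc, sub_self]
          · rw [hη' τ hc, h, sub_self]
        · exact Finset.mem_filter.2 ⟨Finset.mem_univ _, hσ⟩
        · rw [Finset.mem_filter, hsub, hη σ (IsConj.refl _), sub_self]
          simp)
      rw [← sub_add_cancel ξ η]
      exact Submodule.add_mem _ hmem (Submodule.subset_span ⟨_, _, rfl⟩)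
    · push Not at h0
      have : ξ = 0 := Subtype.ext (ext_coeff h0)
      rw [this]
      exact Submodule.zero_mem _

end OrbitSums

/-! ### The central form as a coefficient of `1`. -/

section CentralForm

variable {L G : Type*} [Field L] [Group G] [MulSemiringAction Gᵐᵒᵖ L]

instance : Algebra.IsInvariant (baseField L G) L Gᵐᵒᵖ := ⟨fun b hb => ⟨⟨b, hb⟩, rfl⟩⟩

instance (ν : G) : Algebra.IsInvariant (centralizerField L ν) L (Subgroup.centralizer {ν}).op :=
  ⟨fun b hb => ⟨⟨b, hb⟩, rfl⟩⟩

instance (ν : G) : SMulCommClass (Subgroup.centralizer {ν}).op (centralizerField L ν) L :=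
  ⟨fun c k y => by
    rw [Algebra.smul_def, Algebra.smul_def, smul_mul']
    congr 1
    exact k.2 c⟩

theorem card_ker_toAlgAut : Nat.card (MulSemiringAction.toAlgAut Gᵐᵒᵖ (baseField L G) L).ker =
    Nat.card (kernel L G) :=
  Nat.card_congr
    { toFun := fun g => ⟨g.1.unop, mem_kernel.2 fun y => AlgEquiv.congr_fun g.2 y⟩
      invFun := fun g => ⟨MulOpposite.op g.1, AlgEquiv.ext fun y => mem_kernel.1 g.2 y⟩
      left_inv := fun _ => rfl
      right_inv := fun _ => rfl }

theorem card_ker_toAlgAut_centralizer (ν : G) :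
    Nat.card (MulSemiringAction.toAlgAut (Subgroup.centralizer {ν}).op
      (centralizerField L ν) L).ker =
    Nat.card ((Subgroup.centralizer {ν}).subgroupOf (kernel L G)) :=
  Nat.card_congr
    { toFun := fun g => ⟨⟨g.1.1.unop, mem_kernel.2 fun y => AlgEquiv.congr_fun g.2 y⟩, g.1.2⟩
      invFun := fun g => ⟨⟨MulOpposite.op g.1.1, g.2⟩, AlgEquiv.ext fun y => mem_kernel.1 g.1.2 y⟩
      left_inv := fun _ => rfl
      right_inv := fun _ => rfl }

variable (L G) in
/-- The coefficient of `1`, as a linear form on the centre of `L ≀ G`. -/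
noncomputable def centralCoeff :
    Subalgebra.center (baseField L G) (TwistedGroupRing L G) →ₗ[baseField L G] baseField L G where
  toFun ξ := ⟨coeff (ξ : TwistedGroupRing L G) 1, coeff_one_mem_baseField ξ⟩
  map_add' _ _ := Subtype.ext (coeff_add _ _ _)
  map_smul' _ _ := Subtype.ext (coeff_smul _ _ _)

variable (L G) in
/-- The form sending a pair of central elements to the coefficient of `1` in their product. -/
noncomputable def centralForm : LinearMap.BilinForm (baseField L G)
    (Subalgebra.center (baseField L G) (TwistedGroupRing L G)) :=
  (LinearMap.mul (baseField L G) _).compr₂ (centralCoeff L G)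

theorem centralForm_apply (ξ η : Subalgebra.center (baseField L G) (TwistedGroupRing L G)) :
    centralForm L G ξ η = centralCoeff L G (ξ * η) := rfl

theorem centralForm_isSymm : (centralForm L G).IsSymm :=
  ⟨fun ξ η => by rw [centralForm_apply, centralForm_apply, mul_comm]⟩

variable [Finite G]

instance : Finite Gᵐᵒᵖ := Finite.of_equiv G MulOpposite.opEquiv

theorem card_eq_card_kernel_mul_finrank :
    Nat.card G = Nat.card (kernel L G) * Module.finrank (baseField L G) L := by
  rw [← card_ker_toAlgAut, ← card_eq_card_ker_mul_finrank Gᵐᵒᵖ (baseField L G) L]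
  exact Nat.card_congr MulOpposite.opEquiv

theorem sum_smul_op_eq [Fintype G] (y : L) :
    ∑ σ : G, y <• σ = (Nat.card (kernel L G) : L) *
      algebraMap (baseField L G) L (Algebra.trace (baseField L G) L y) := by
  have := Fintype.ofFinite Gᵐᵒᵖ
  rw [← card_ker_toAlgAut, ← sum_smul_eq_card_mul_trace Gᵐᵒᵖ (baseField L G) L y]
  exact Fintype.sum_equiv MulOpposite.opEquiv _ _ fun _ => rfl

/-- The sum of the conjugates of `w ∈ L_ν` over `C_G(ν)\G`. -/
noncomputable def conjSum (ν : G) (w : centralizerField L ν) : L :=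
  ∑ᶠ q : Quotient (QuotientGroup.rightRel (Subgroup.centralizer {ν})),
    Quotient.lift (fun ρ : G => (w : L) <• ρ) (fun a b h => by
      have h' := QuotientGroup.rightRel_apply.1 h
      rw [Subgroup.mem_centralizer_singleton_iff] at h'
      have h1 := mem_centralizerField.1 w.2 _ h'.symm
      conv_lhs => rw [← h1]
      rw [← mul_smul, ← MulOpposite.op_mul, inv_mul_cancel_right]) q

/-- Take `u` with `Tr_{L/L_ν}(u) = 1` and evaluate `∑_{σ ∈ G} (w u)^σ` twice. Over all of `G` it is
`n Tr_{L/K}(w u) = n Tr_{L_ν/K}(w)`; each coset `C_G(ν) ρ` contributes `|C_N(ν)| w^ρ`. -/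
theorem card_mul_conjSum (ν : G) (w : centralizerField L ν) :
    (Nat.card ((Subgroup.centralizer {ν}).subgroupOf (kernel L G)) : L) * conjSum ν w =
      (Nat.card (kernel L G) : L) * algebraMap (baseField L G) L
        (Algebra.trace (baseField L G) (centralizerField L ν) w) := by
  classical
  cases nonempty_fintype G
  have := Fintype.ofFinite (Subgroup.centralizer {ν}).op
  have := Fintype.ofFinite (Quotient (QuotientGroup.rightRel (Subgroup.centralizer {ν})))
  obtain ⟨u, hu⟩ := Algebra.trace_surjective (centralizerField L ν) L 1
  have hw : Algebra.trace (baseField L G) (centralizerField L ν) w =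
      Algebra.trace (baseField L G) L ((w : L) * u) := by
    have h := Algebra.trace_trace (R := baseField L G) (S := centralizerField L ν) ((w : L) * u)
    have : (w : L) * u = w • u := rfl
    rw [← h, this, map_smul, hu, smul_eq_mul, mul_one]
  have hsum := sum_smul_eq_card_mul_trace (Subgroup.centralizer {ν}).op (centralizerField L ν) L u
  rw [hu, map_one, mul_one, card_ker_toAlgAut_centralizer] at hsum
  rw [hw, ← sum_smul_op_eq, conjSum, finsum_eq_sum_of_fintype, Finset.mul_sum,
    ← Finset.sum_fiberwise (s := Finset.univ)
      (g := Quotient.mk (QuotientGroup.rightRel (Subgroup.centralizer {ν})))]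
  refine Finset.sum_congr rfl fun q _ => ?_
  induction q using Quotient.inductionOn with
  | h ρ =>
    change _ * ((w : L) <• ρ) = _
    have h1 : ∑ σ ∈ Finset.univ.filter (fun σ =>
        Quotient.mk (QuotientGroup.rightRel (Subgroup.centralizer {ν})) σ = Quotient.mk _ ρ),
        ((w : L) * u) <• σ =
        ∑ c : (Subgroup.centralizer {ν}).op, ((w : L) * u) <• (c.1.unop * ρ) := by
      symm
      refine Finset.sum_bij (fun c _ => c.1.unop * ρ) (fun c _ => ?_) (fun c _ d _ h => ?_)
        (fun σ hσ => ?_) (fun _ _ => rfl)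
      · rw [Finset.mem_filter]
        refine ⟨Finset.mem_univ _, Quotient.sound ?_⟩
        change QuotientGroup.rightRel _ _ _
        rw [QuotientGroup.rightRel_apply, mul_inv_rev, mul_inv_cancel_left]
        exact inv_mem c.2
      · exact Subtype.ext (MulOpposite.unop_injective (mul_right_cancel h))
      · have h := Quotient.exact (Finset.mem_filter.1 hσ).2
        change QuotientGroup.rightRel _ _ _ at h
        rw [QuotientGroup.rightRel_apply] at h
        refine ⟨⟨MulOpposite.op (σ * ρ⁻¹), ?_⟩, Finset.mem_univ _, inv_mul_cancel_right _ _⟩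
        have := inv_mem h
        rwa [mul_inv_rev, inv_inv] at this
    rw [h1]
    have h2 : ∀ c : (Subgroup.centralizer {ν}).op,
        ((w : L) * u) <• (c.1.unop * ρ) = ((w : L) <• ρ) * ((c • u) <• ρ) := fun c => by
      rw [smul_mul_op, smul_mul', smul_mul']
      congr 2
      exact w.2 c
    rw [Finset.sum_congr rfl fun c _ => h2 c, ← Finset.mul_sum, ← Finset.smul_sum, hsum, mul_comm]
    congr 1
    exact (map_natCast (MulSemiringAction.toRingHom Gᵐᵒᵖ L (MulOpposite.op ρ)) _).symm

/-- Since `|C_N(ν)|` divides the invertible `n`, it can be cancelled, leaving the index. -/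
theorem conjSum_eq (hn : (Nat.card (kernel L G) : baseField L G) ≠ 0)
    (ν : G) (w : centralizerField L ν) :
    conjSum ν w = algebraMap (baseField L G) L
      (((Subgroup.centralizer {ν}).relIndex (kernel L G) : baseField L G) *
        Algebra.trace (baseField L G) (centralizerField L ν) w) := by
  have h := card_mul_conjSum ν w
  have hn' : (Nat.card (kernel L G) : L) ≠ 0 := fun h0 => hn (Subtype.ext (by simpa using h0))
  have hc : Nat.card ((Subgroup.centralizer {ν}).subgroupOf (kernel L G)) *
      (Subgroup.centralizer {ν}).relIndex (kernel L G) = Nat.card (kernel L G) :=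
    Subgroup.card_mul_index _
  rw [← hc, Nat.cast_mul] at hn'
  rw [← hc, Nat.cast_mul, mul_assoc] at h
  rw [mul_left_cancel₀ (left_ne_zero_of_mul hn') h, map_mul, map_natCast]

/-- The term at `ρ⁻¹ ν ρ` meets only the coefficient of `ξ` at its inverse, which by equivariance is
the `ρ`-conjugate of the coefficient at `ν⁻¹`. -/
theorem coeff_orbitSum_mul (ν : kernel L G) (y : centralizerField L (ν : G))
    (ξ : Subalgebra.center (baseField L G) (TwistedGroupRing L G))
    (w : centralizerField L (ν : G))
    (hw : (w : L) = (y : L) * coeff (ξ : TwistedGroupRing L G) (ν : G)⁻¹) :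
    coeff ((orbitSum ν y * ξ : Subalgebra.center (baseField L G) (TwistedGroupRing L G)) :
      TwistedGroupRing L G) 1 = conjSum (ν : G) w := by
  have := Fintype.ofFinite (Quotient (QuotientGroup.rightRel (Subgroup.centralizer {(ν : G)})))
  change coeff (orbitSumAux (ν : G) y * (ξ : TwistedGroupRing L G)) 1 = _
  rw [orbitSumAux, conjSum, finsum_eq_sum_of_fintype, finsum_eq_sum_of_fintype, Finset.sum_mul,
    coeff_sum]
  refine Finset.sum_congr rfl fun q _ => ?_
  induction q using Quotient.inductionOn with
  | h ρ =>
    change coeff (single (ρ⁻¹ * (ν : G) * ρ) ((y : L) <• ρ) * (ξ : TwistedGroupRing L G)) 1 = (w : L) <• ρ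
    have h1 : (ρ⁻¹ * (ν : G) * ρ)⁻¹ * 1 = ρ⁻¹ * (ν : G)⁻¹ * ρ := by group
    rw [coeff_single_mul, h1, (mem_center_iff.1 ξ.2).2, hw, smul_mul', ← smul_mul_op]
    congr 1
    have h2 : ρ * (ρ⁻¹ * (ν : G)⁻¹ * ρ) = (ν : G)⁻¹ * ρ := by group
    rw [h2, smul_mul_op, mem_kernel.1 (inv_mem ν.2)]

theorem centralCoeff_orbitSum_mul (hn : (Nat.card (kernel L G) : baseField L G) ≠ 0)
    (ν : kernel L G) (y : centralizerField L (ν : G))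
    (ξ : Subalgebra.center (baseField L G) (TwistedGroupRing L G))
    (w : centralizerField L (ν : G))
    (hw : (w : L) = (y : L) * coeff (ξ : TwistedGroupRing L G) (ν : G)⁻¹) :
    centralCoeff L G (orbitSum ν y * ξ) =
      ((Subgroup.centralizer {(ν : G)}).relIndex (kernel L G) : baseField L G) *
        Algebra.trace (baseField L G) (centralizerField L (ν : G)) w :=
  Subtype.ext ((coeff_orbitSum_mul ν y ξ w hw).trans (conjSum_eq hn _ w))

theorem isCentralForm_centralForm (hn : (Nat.card (kernel L G) : baseField L G) ≠ 0) :
    IsCentralForm (centralForm L G) where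
  apply_of_conj ν ν' y y' τ h := by
    rw [centralForm_apply]
    refine centralCoeff_orbitSum_mul hn ν y _ _ ?_
    have h1 : (ν : G)⁻¹ = τ⁻¹ * (ν' : G) * τ := by rw [h]; group
    rw [h1, coeff_orbitSum_conj]
  apply_of_not_conj ν ν' y y' h := by
    -- Here `w = 0`: the second orbit sum has no term at `ν⁻¹`.
    rw [centralForm_apply, centralCoeff_orbitSum_mul hn ν y _ 0, map_zero, mul_zero]
    rw [coeff_orbitSum_of_not_isConj, mul_zero, ZeroMemClass.coe_zero]
    intro hc
    obtain ⟨c, hc⟩ := isConj_iff.1 hc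
    refine h (isConj_iff.2 ⟨c⁻¹, ?_⟩)
    rw [← inv_inv (ν : G), ← hc]
    group

theorem IsCentralForm.eq {B B' : LinearMap.BilinForm (baseField L G)
    (Subalgebra.center (baseField L G) (TwistedGroupRing L G))}
    (hB : IsCentralForm B) (hB' : IsCentralForm B') : B = B' := by
  refine LinearMap.ext_on span_orbitSum fun ξ hξ => LinearMap.ext_on span_orbitSum fun η hη => ?_
  obtain ⟨ν, y, rfl⟩ := hξ
  obtain ⟨ν', y', rfl⟩ := hη
  by_cases h : IsConj (ν : G) (ν' : G)⁻¹
  · obtain ⟨c, hc⟩ := isConj_iff.1 h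
    have h' : (ν : G) = c⁻¹ * (ν' : G)⁻¹ * c := by rw [← hc]; group
    rw [hB.apply_of_conj _ _ _ _ c h', hB'.apply_of_conj _ _ _ _ c h']
  · rw [hB.apply_of_not_conj _ _ _ _ h, hB'.apply_of_not_conj _ _ _ _ h]

end CentralForm

/-! ### Semisimplicity of the twisted group ring. -/

section Maschke

variable {L G : Type*} [Field L] [Group G] [MulSemiringAction Gᵐᵒᵖ L]

/-- The group element `σ`, acting on right modules. -/
noncomputable def opGroup (σ : G) : (TwistedGroupRing L G)ᵐᵒᵖ := MulOpposite.op (single σ 1)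

/-- The field `L`, acting on right modules. -/
noncomputable def opField : L →+* (TwistedGroupRing L G)ᵐᵒᵖ where
  toFun y := MulOpposite.op (single 1 y)
  map_one' := rfl
  map_mul' y z := by
    rw [← MulOpposite.op_mul, single_mul_single]
    simp [mul_comm]
  map_zero' := by rw [single_zero]; rfl
  map_add' y z := by rw [single_add]; rfl

theorem op_single (σ : G) (y : L) : MulOpposite.op (single σ y) = opField y * opGroup σ := by
  change _ = MulOpposite.op (single σ 1 * single 1 y)
  rw [single_mul_single]
  simp

theorem opGroup_mul (σ τ : G) : (opGroup σ * opGroup τ : (TwistedGroupRing L G)ᵐᵒᵖ) =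
    opGroup (τ * σ) := by
  change MulOpposite.op (single τ 1 * single σ 1) = _
  rw [single_mul_single]
  simp [opGroup]

theorem opGroup_one : (opGroup 1 : (TwistedGroupRing L G)ᵐᵒᵖ) = 1 := rfl

theorem opGroup_mul_opField (σ : G) (y : L) :
    (opGroup σ * opField y : (TwistedGroupRing L G)ᵐᵒᵖ) = opField (y <• σ) * opGroup σ := by
  rw [← op_single]
  change MulOpposite.op (single 1 y * single σ 1) = _
  rw [single_mul_single]
  simp

theorem op_induction {p : (TwistedGroupRing L G)ᵐᵒᵖ → Prop} (t : (TwistedGroupRing L G)ᵐᵒᵖ)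
    (hf : ∀ y, p (opField y)) (hg : ∀ σ, p (opGroup σ)) (hm : ∀ s t, p s → p t → p (s * t))
    (ha : ∀ s t, p s → p t → p (s + t)) : p t := by
  rw [← MulOpposite.op_unop t]
  refine induction_single (p := fun ξ => p (MulOpposite.op ξ)) _ (fun σ y => ?_)
    fun ξ η hξ hη => ha _ _ hξ hη
  rw [op_single]
  exact hm _ _ (hf y) (hg σ)

theorem exists_opField_linear_projection {M : Type*} [AddCommGroup M]
    [Module (TwistedGroupRing L G)ᵐᵒᵖ M] (Y : Submodule (TwistedGroupRing L G)ᵐᵒᵖ M) :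
    ∃ π : M →+ M, (∀ x, π x ∈ Y) ∧ (∀ x ∈ Y, π x = x) ∧
      ∀ (y : L) x, π ((opField y : (TwistedGroupRing L G)ᵐᵒᵖ) • x) =
        (opField y : (TwistedGroupRing L G)ᵐᵒᵖ) • π x := by
  let : Module L M := Module.compHom M (opField : L →+* (TwistedGroupRing L G)ᵐᵒᵖ)
  let Y' : Submodule L M :=
    { Y with smul_mem' := fun y x hx => Y.smul_mem (opField y) hx }
  obtain ⟨f, hf⟩ := LinearMap.exists_leftInverse_of_injective Y'.subtype
    (LinearMap.ker_eq_bot.2 Y'.injective_subtype)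
  refine ⟨(Y'.subtype ∘ₗ f).toAddMonoidHom, fun x => (f x).2, fun x hx => ?_, fun y x => ?_⟩
  · exact congrArg Subtype.val (LinearMap.congr_fun hf ⟨x, hx⟩)
  · exact (Y'.subtype ∘ₗ f).map_smul y x

variable [Finite G]

/-- The sum equals `n Tr_{L/K}(y)`, so any `y` of trace `1/n` works. It replaces the factor `1/|G|`
of the classical argument, as `|G| = n h` may vanish in `K`. -/
theorem exists_sum_smul_op_eq_one (hn : (Nat.card (kernel L G) : baseField L G) ≠ 0)
    [Fintype G] : ∃ y : L, ∑ σ : G, y <• σ = 1 := by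
  obtain ⟨y, hy⟩ := Algebra.trace_surjective (baseField L G) L
    (Nat.card (kernel L G) : baseField L G)⁻¹
  refine ⟨y, ?_⟩
  rw [sum_smul_op_eq, hy, ← map_natCast (algebraMap (baseField L G) L), ← map_mul,
    mul_inv_cancel₀ hn, map_one]

/-- Maschke's theorem for twisted group rings. -/
theorem isSemisimpleModule (hn : (Nat.card (kernel L G) : baseField L G) ≠ 0)
    (M : Type*) [AddCommGroup M] [Module (TwistedGroupRing L G)ᵐᵒᵖ M] :
    IsSemisimpleModule (TwistedGroupRing L G)ᵐᵒᵖ M := by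
  cases nonempty_fintype G
  obtain ⟨y₀, hy₀⟩ := exists_sum_smul_op_eq_one (L := L) hn
  refine (isSemisimpleModule_iff _ _).2 ⟨fun Y => ?_⟩
  obtain ⟨π, hπ, hπY, hπL⟩ := exists_opField_linear_projection Y
  -- The `L`-linear projection is averaged over `G` with the weight `y₀`.
  let f : M →+ M := ∑ σ : G, (DistribSMul.toAddMonoidHom M
    (opGroup σ * opField y₀ : (TwistedGroupRing L G)ᵐᵒᵖ)).comp
      (π.comp (DistribSMul.toAddMonoidHom M (opGroup σ⁻¹ : (TwistedGroupRing L G)ᵐᵒᵖ)))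
  have hf : ∀ x, f x = ∑ σ : G, (opGroup σ * opField y₀ : (TwistedGroupRing L G)ᵐᵒᵖ) •
      π ((opGroup σ⁻¹ : (TwistedGroupRing L G)ᵐᵒᵖ) • x) := fun x => by
    rw [AddMonoidHom.finsetSum_apply]
    rfl
  have hlin : ∀ (t : (TwistedGroupRing L G)ᵐᵒᵖ) (x : M), f (t • x) = t • f x := by
    intro t
    induction t using op_induction with
    | hf z =>
      intro x
      rw [hf, hf, Finset.smul_sum]
      refine Finset.sum_congr rfl fun σ _ => ?_
      have h1 : (opGroup σ * opField y₀ * opField (z <• σ⁻¹) : (TwistedGroupRing L G)ᵐᵒᵖ) =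
          opField z * (opGroup σ * opField y₀) := by
        rw [mul_assoc, ← map_mul, mul_comm y₀, map_mul, ← mul_assoc, opGroup_mul_opField,
          ← smul_mul_op, inv_mul_cancel, MulOpposite.op_one, one_smul, mul_assoc]
      rw [← mul_smul (opGroup σ⁻¹), opGroup_mul_opField σ⁻¹, mul_smul (opField (z <• σ⁻¹)), hπL,
        ← mul_smul, h1, mul_smul]
    | hg τ =>
      intro x
      rw [hf, hf, Finset.smul_sum]
      refine Fintype.sum_equiv (Equiv.mulRight τ⁻¹) _ _ fun σ => ?_
      rw [← mul_smul, ← mul_smul, ← mul_assoc, opGroup_mul, opGroup_mul]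
      simp
    | hm s t hs ht => intro x; rw [mul_smul, hs, ht, mul_smul]
    | ha s t hs ht => intro x; rw [add_smul, map_add, hs, ht, add_smul]
  have hfY : ∀ x, f x ∈ Y := fun x => by
    rw [hf]
    exact Y.sum_mem fun σ _ => Y.smul_mem _ (hπ _)
  let F : M →ₗ[(TwistedGroupRing L G)ᵐᵒᵖ] Y :=
    { toFun := fun x => ⟨f x, hfY x⟩
      map_add' := fun x y => Subtype.ext (map_add f x y)
      map_smul' := fun t x => Subtype.ext (hlin t x) }
  refine ⟨LinearMap.ker F, LinearMap.isCompl_of_proj fun x => Subtype.ext ?_⟩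
  change f x = x
  rw [hf]
  -- On `Y` the projection drops out and the average reduces to multiplication by `∑ y₀^σ = 1`.
  have : ∀ σ : G, (opGroup σ * opField y₀ : (TwistedGroupRing L G)ᵐᵒᵖ) •
      π ((opGroup σ⁻¹ : (TwistedGroupRing L G)ᵐᵒᵖ) • (x : M)) =
      (opField (y₀ <• σ) : (TwistedGroupRing L G)ᵐᵒᵖ) • (x : M) := fun σ => by
    rw [hπY _ (Y.smul_mem _ x.2), ← mul_smul, opGroup_mul_opField, mul_assoc, opGroup_mul,
      inv_mul_cancel, opGroup_one, mul_one]
  rw [Finset.sum_congr rfl fun σ _ => this σ, ← Finset.sum_smul, ← map_sum, hy₀, map_one, one_smul]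

end Maschke

end TwistedGroupRing

/-! ### Double centralizer and dimension of a block. -/

section SimpleFamily

open Module (End)

theorem isField_subalgebra_center (K D : Type*) [Field K] [DivisionRing D] [Algebra K D] :
    IsField (Subalgebra.center K D) :=
  (IsSimpleRing.isField_center D : IsField (Subring.center D))

theorem finrank_subalgebra_center (K D : Type*) [Field K] [DivisionRing D] [Algebra K D] :
    Module.finrank (Subalgebra.center K D) D = Module.finrank (Subring.center D) D := by
  refine congrArg Cardinal.toNat (rank_eq_of_equiv_equiv
    (fun z : Subalgebra.center K D => (⟨z.1, z.2⟩ : Subring.center D)) (AddEquiv.refl D)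
    ⟨fun a b h => Subtype.ext (congrArg (fun z : Subring.center D => (z : D)) h),
      fun z => ⟨⟨z.1, z.2⟩, rfl⟩⟩ fun _ _ => rfl)

theorem finrank_eq_center_mul (K D : Type*) [Field K] [DivisionRing D] [Algebra K D] :
    Module.finrank K D = Module.finrank K (Subalgebra.center K D) *
      Module.finrank (Subring.center D) D := by
  let : Field (Subalgebra.center K D) := (isField_subalgebra_center K D).toField
  rw [← finrank_subalgebra_center K D, Module.finrank_mul_finrank]

theorem finrank_end_eq (K D X : Type*) [Field K] [DivisionRing D] [Algebra K D] [AddCommGroup X]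
    [Module K X] [Module D X] [IsScalarTower K D X] [SMulCommClass D K X] [Module.Finite D X]
    [Module.Finite K X] :
    Module.finrank K (X →ₗ[D] X) = Module.finrank D X ^ 2 * Module.finrank K D := by
  rw [← ((Module.finBasis D X).constr K).finrank_eq, Module.finrank_pi_fintype, Finset.sum_const,
    ← Module.finrank_mul_finrank K D X]
  simp
  ring

theorem finite_of_isSimpleModule (K : Type*) {T X : Type*} [Field K] [Ring T] [Algebra K T]
    [Module.Finite K T] [AddCommGroup X] [Module T X] [Module K X] [IsScalarTower K T X]
    [IsSimpleModule T X] : Module.Finite K X :=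
  Module.Finite.trans T X

/-- The double centralizer theorem for a semisimple module with pairwise nonisomorphic simple
summands. -/
theorem exists_smul_eq_of_simple_family (K : Type*) {T : Type*} [Field K] [Ring T] [Algebra K T]
    [Module.Finite K T] {ι : Type*} [Fintype ι] {X : ι → Type*} [∀ i, AddCommGroup (X i)]
    [∀ i, Module T (X i)] [∀ i, Module K (X i)] [∀ i, IsScalarTower K T (X i)]
    [IsSemisimpleRing T] (hs : ∀ i, IsSimpleModule T (X i))
    (hX : ∀ i j, Nonempty (X i ≃ₗ[T] X j) → i = j)
    (f : ∀ i, End (End T (X i)) (X i)) : ∃ t : T, ∀ i (x : X i), t • x = f i x := by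
  classical
  -- By Schur's lemma the off-diagonal components of `g` vanish, so the family `f` commutes with
  -- `End T (∀ i, X i)` and density applies to it.
  have hend : ∀ (g : End T (∀ i, X i)) (x : ∀ i, X i) (i : ι),
      g x i = (LinearMap.proj i ∘ₗ g ∘ₗ LinearMap.single T X i) (x i) := by
    intro g x i
    conv_lhs => rw [← Finset.univ_sum_single x, map_sum, Finset.sum_apply]
    refine Finset.sum_eq_single i (fun j _ hj => ?_) (by simp)
    have hg : LinearMap.proj i ∘ₗ g ∘ₗ LinearMap.single T X j = 0 := by
      refine (LinearMap.bijective_or_eq_zero _).resolve_left fun hb => hj ?_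
      exact hX j i ⟨LinearEquiv.ofBijective _ hb⟩
    exact LinearMap.congr_fun hg (x j)
  let F : End (End T (∀ i, X i)) (∀ i, X i) :=
    { toFun := fun x i => f i (x i)
      map_add' := fun x y => funext fun i => map_add (f i) _ _
      map_smul' := fun g x => funext fun i => by
        rw [RingHom.id_apply, Module.End.smul_def, Module.End.smul_def, hend, hend]
        exact (f i).map_smul (LinearMap.proj i ∘ₗ g ∘ₗ LinearMap.single T X i : End T (X i)) (x i) }
  have hfin : ∀ i, Module.Finite K (X i) := fun i => finite_of_isSimpleModule K (T := T)
  obtain ⟨s, hs⟩ := (inferInstance : Module.Finite K (∀ i, X i)).fg_top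
  obtain ⟨t, ht⟩ := jacobson_density F s
  have hall : ∀ x, F x = t • x := by
    intro x
    have hx : x ∈ Submodule.span K (s : Set (∀ i, X i)) := hs ▸ Submodule.mem_top
    induction hx using Submodule.span_induction with
    | mem m hm => exact ht m hm
    | zero => simp
    | add a b _ _ ha hb => rw [map_add, ha, hb, smul_add]
    | smul k a _ ha =>
      -- Scalars of `K` are endomorphisms of the product, so `F` is `K`-linear and agreement on
      -- finitely many generators suffices.
      have h1 := F.map_smul (k • (1 : End T (∀ i, X i))) a
      have h2 : (k • (1 : End T (∀ i, X i))) • a = k • a := rfl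
      rw [h2] at h1
      rw [h1, ha]
      change k • t • a = t • k • a
      rw [smul_comm]
  refine ⟨t, fun i x => ?_⟩
  have := congrFun (hall (Pi.single i x)) i
  change f i (Pi.single i x i) = t • (Pi.single i x i : X i) at this
  rwa [Pi.single_eq_same, eq_comm] at this

variable {K T : Type*} [Field K] [Ring T] [Algebra K T] [Module.Finite K T]
  {ι : Type*} [Fintype ι] {X : ι → Type*} [∀ i, AddCommGroup (X i)] [∀ i, Module T (X i)]
  [∀ i, Module K (X i)] [∀ i, IsScalarTower K T (X i)]

/-- Central endomorphisms of the simple modules are induced by a central ring element. -/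
theorem exists_center_smul_eq_of_simple_family [IsSemisimpleRing T]
    (hs : ∀ i, IsSimpleModule T (X i)) (hX : ∀ i j, Nonempty (X i ≃ₗ[T] X j) → i = j)
    (hfaith : ∀ t : T, (∀ i (x : X i), t • x = 0) → t = 0)
    (z : ∀ i, Subalgebra.center K (End T (X i))) :
    ∃ t ∈ Subalgebra.center K T, ∀ i (x : X i), t • x = (z i : End T (X i)) x := by
  obtain ⟨t, ht⟩ := exists_smul_eq_of_simple_family K hs hX fun i =>
    { toFun := (z i : End T (X i))
      map_add' := map_add _
      map_smul' := fun g x => LinearMap.congr_fun (Subalgebra.mem_center_iff.1 (z i).2 g).symm x }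
  refine ⟨t, Subalgebra.mem_center_iff.2 fun s => ?_, ht⟩
  rw [← sub_eq_zero]
  refine hfaith _ fun i x => ?_
  rw [sub_smul, mul_smul, mul_smul, ht, ht]
  change s • (z i : End T (X i)) x - (z i : End T (X i)) (s • x) = 0
  rw [map_smul, sub_self]

/-- The action on `X i` identifies `e T` with `End_{K_i}(X i)`: injectively by faithfulness, since
`e` kills the other simples, and surjectively by the double centralizer theorem. -/
theorem finrank_block_eq [IsSemisimpleRing T]
    (hs : ∀ i, IsSimpleModule T (X i)) (hX : ∀ i j, Nonempty (X i ≃ₗ[T] X j) → i = j)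
    (hfaith : ∀ t : T, (∀ i (x : X i), t • x = 0) → t = 0) (i : ι) (e : T)
    (he : ∀ x : X i, e • x = x) (he' : ∀ j ≠ i, ∀ x : X j, e • x = 0) :
    Module.finrank K (LinearMap.range (LinearMap.mulLeft K e)) =
      Module.finrank (End T (X i)) (X i) ^ 2 *
        (Module.finrank K (Subalgebra.center K (End T (X i))) *
          Module.finrank (Subring.center (End T (X i))) (End T (X i))) := by
  classical
  let : DivisionRing (End T (X i)) := Module.End.instDivisionRing
  have : Module.Finite K (X i) := finite_of_isSimpleModule K (T := T)
  have : Module.Finite (End T (X i)) (X i) := Module.Finite.of_restrictScalars_finite K _ _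
  have h1 := finrank_eq_center_mul K (End T (X i))
  have h2 := finrank_end_eq K (End T (X i)) (X i)
  rw [← h1, ← h2]
  let A : T →ₗ[K] End (End T (X i)) (X i) :=
    { toFun := Module.toModuleEnd (End T (X i)) (S := T) (X i)
      map_add' := map_add _
      map_smul' := fun k t => LinearMap.ext fun x => smul_assoc k t x }
  refine (LinearEquiv.ofBijective (A ∘ₗ (LinearMap.range (LinearMap.mulLeft K e)).subtype)
    ⟨?_, ?_⟩).finrank_eq
  · rw [injective_iff_map_eq_zero]
    rintro ⟨_, t, rfl⟩ ht
    refine Subtype.ext (hfaith _ fun j x => ?_)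
    by_cases hj : j = i
    · subst hj
      exact LinearMap.congr_fun ht x
    · change (e * t) • x = 0
      rw [mul_smul, he' j hj]
  · intro f
    obtain ⟨t, ht⟩ := exists_smul_eq_of_simple_family K hs hX (Pi.single i f)
    refine ⟨⟨_, t, rfl⟩, LinearMap.ext fun x => ?_⟩
    change (e * t) • x = f x
    rw [mul_smul, he, ht, Pi.single_eq_same]

theorem isField_center_end (K T X : Type*) [Field K] [Ring T] [Algebra K T] [AddCommGroup X]
    [Module T X] [Module K X] [IsScalarTower K T X] [IsSimpleModule T X] :
    IsField (Subalgebra.center K (End T X)) := by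
  classical
  let : DivisionRing (End T X) := Module.End.instDivisionRing
  exact isField_subalgebra_center K (End T X)

theorem sqrt_finrank_center_end_sq (T X : Type*) [Ring T] [AddCommGroup X] [Module T X]
    [IsSimpleModule T X] :
    Nat.sqrt (Module.finrank (Subring.center (End T X)) (End T X)) ^ 2 =
      Module.finrank (Subring.center (End T X)) (End T X) := by
  classical
  let : DivisionRing (End T X) := Module.End.instDivisionRing
  exact sqrt_finrank_center_sq (End T X)

end SimpleFamily

namespace TwistedGroupRing

/-! ### Traces on the group ring of the kernel. -/

section KernelTrace

variable {L G : Type*} [Field L] [Group G] [MulSemiringAction Gᵐᵒᵖ L]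

variable (L G) in
open Classical in
/-- The projection onto the functions supported on the kernel. -/
noncomputable def restrictKernel : (G → L) →ₗ[L] (G → L) where
  toFun f σ := if σ ∈ kernel L G then f σ else 0
  map_add' f g := funext fun σ => by
    by_cases h : σ ∈ kernel L G <;> simp [h]
  map_smul' c f := funext fun σ => by
    by_cases h : σ ∈ kernel L G <;> simp [h]

theorem restrictKernel_of_mem (f : G → L) {σ : G} (h : σ ∈ kernel L G) :
    restrictKernel L G f σ = f σ := if_pos h

theorem restrictKernel_of_notMem (f : G → L) {σ : G} (h : σ ∉ kernel L G) :
    restrictKernel L G f σ = 0 := if_neg h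

theorem restrictKernel_eq_self_iff (f : G → L) :
    restrictKernel L G f = f ↔ ∀ σ ∉ kernel L G, f σ = 0 := by
  constructor
  · intro h σ hσ
    rw [← h, restrictKernel_of_notMem f hσ]
  · intro h
    funext σ
    by_cases hσ : σ ∈ kernel L G
    · exact restrictKernel_of_mem f hσ
    · rw [restrictKernel_of_notMem f hσ, h σ hσ]

theorem restrictKernel_restrictKernel (f : G → L) :
    restrictKernel L G (restrictKernel L G f) = restrictKernel L G f :=
  (restrictKernel_eq_self_iff _).2 fun _ hσ => restrictKernel_of_notMem f hσ

instance : (kernel L G).Normal := ⟨fun ν hν τ => mem_kernel.2 fun y => by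
  rw [smul_mul_op, smul_mul_op, mem_kernel.1 hν, ← smul_mul_op, mul_inv_cancel,
    MulOpposite.op_one, one_smul]⟩

/-- Conjugation by `σ` in coordinates. -/
noncomputable def conjEquiv (σ : G) : (G → L) ≃+ (G → L) where
  toFun f ρ := f (σ * ρ * σ⁻¹) <• σ
  invFun f ρ := f (σ⁻¹ * ρ * σ) <• σ⁻¹
  left_inv f := funext fun ρ => by
    change f (σ * (σ⁻¹ * ρ * σ) * σ⁻¹) <• σ <• σ⁻¹ = f ρ
    rw [← smul_mul_op]
    simp [mul_assoc]
  right_inv f := funext fun ρ => by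
    change f (σ⁻¹ * (σ * ρ * σ⁻¹) * σ) <• σ⁻¹ <• σ = f ρ
    rw [← smul_mul_op]
    simp [mul_assoc]
  map_add' f g := funext fun ρ => smul_add _ _ _

theorem conjEquiv_apply (σ ρ : G) (f : G → L) : conjEquiv σ f ρ = f (σ * ρ * σ⁻¹) <• σ := rfl

theorem conjEquiv_smul (σ : G) (c : L) (f : G → L) :
    conjEquiv σ (c • f) = (c <• σ) • conjEquiv σ f := funext fun ρ => by
  rw [conjEquiv_apply, Pi.smul_apply, Pi.smul_apply, smul_eq_mul, smul_mul', smul_eq_mul,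
    conjEquiv_apply]

theorem conjEquiv_coeff (σ : G) (η : TwistedGroupRing L G) :
    conjEquiv σ (coeff η) = coeff (single σ⁻¹ 1 * η * single σ 1) := funext fun ρ => by
  rw [conjEquiv_apply, coeff_mul_single, coeff_single_mul, inv_inv, smul_one, one_mul, mul_one,
    mul_assoc]

theorem conjEquiv_restrictKernel (σ : G) (f : G → L) :
    conjEquiv σ (restrictKernel L G f) = restrictKernel L G (conjEquiv σ f) := funext fun ρ => by
  rw [conjEquiv_apply]
  have hN : (kernel L G).Normal := inferInstance
  by_cases h : ρ ∈ kernel L G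
  · rw [restrictKernel_of_mem _ h, restrictKernel_of_mem _ (hN.conj_mem _ h _), conjEquiv_apply]
  · rw [restrictKernel_of_notMem _ h, restrictKernel_of_notMem, smul_zero]
    intro h'
    refine h ?_
    have := hN.conj_mem _ h' σ⁻¹
    simpa [mul_assoc] using this

variable [Finite G]

theorem coeff_mul [Fintype G] (ξ η : TwistedGroupRing L G) (σ : G) :
    coeff (ξ * η) σ = ∑ τ, (coeff ξ (σ * τ⁻¹) <• τ) * coeff η τ := by
  classical
  have h : η = ∑ τ, single τ (coeff η τ) := ext_coeff fun σ => by
    rw [coeff_sum]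
    simp [coeff_single]
  conv_lhs => rw [h]
  rw [Finset.mul_sum, coeff_sum]
  exact Finset.sum_congr rfl fun τ _ => coeff_mul_single σ τ _ ξ

/-- Scalars act in coordinates by right multiplication, which is why left multiplications are
`L`-linear. -/
theorem coeffEquiv_symm_smul (c : L) (f : G → L) :
    (coeffEquiv L G).symm (c • f) = (coeffEquiv L G).symm f * single 1 c := by
  refine ext_coeff fun σ => ?_
  rw [coeff_mul_single, coeff_coeffEquiv_symm, coeff_coeffEquiv_symm]
  simp [mul_comm]

/-- Left multiplication by an element of `L ≀ G` in coordinates. -/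
noncomputable def leftRegular (ξ : TwistedGroupRing L G) : (G → L) →ₗ[L] (G → L) where
  toFun f := coeff (ξ * (coeffEquiv L G).symm f)
  map_add' f g := by
    rw [map_add, mul_add]
    exact funext fun σ => coeff_add _ _ σ
  map_smul' c f := by
    rw [coeffEquiv_symm_smul, ← mul_assoc]
    funext σ
    rw [coeff_mul_single]
    simp [mul_comm]

theorem leftRegular_apply (ξ : TwistedGroupRing L G) (f : G → L) :
    leftRegular ξ f = coeff (ξ * (coeffEquiv L G).symm f) := rfl

theorem leftRegular_coeff (ξ η : TwistedGroupRing L G) :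
    leftRegular ξ (coeff η) = coeff (ξ * η) := by
  rw [leftRegular_apply]
  congr 2
  exact (coeffEquiv L G).symm_apply_apply η

theorem leftRegular_mul_apply (ξ η : TwistedGroupRing L G) (f : G → L) :
    leftRegular (ξ * η) f = leftRegular ξ (leftRegular η f) := by
  rw [leftRegular_apply η, leftRegular_coeff, leftRegular_apply, mul_assoc]

theorem leftRegular_add (ξ η : TwistedGroupRing L G) :
    leftRegular (ξ + η) = leftRegular ξ + leftRegular η := by
  refine LinearMap.ext fun f => funext fun σ => ?_
  rw [leftRegular_apply, add_mul, coeff_add]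
  rfl

theorem leftRegular_smul (c : baseField L G) (ξ : TwistedGroupRing L G) :
    leftRegular (c • ξ) = c • leftRegular ξ := by
  refine LinearMap.ext fun f => funext fun σ => ?_
  rw [leftRegular_apply, smul_mul_assoc, coeff_smul]
  rfl

/-- Central elements are supported on `N`, so multiplying by them preserves both the functions
supported on `N` and those supported off it. -/
theorem leftRegular_restrictKernel
    (ξ : Subalgebra.center (baseField L G) (TwistedGroupRing L G)) (f : G → L) :
    leftRegular (ξ : TwistedGroupRing L G) (restrictKernel L G f) =
      restrictKernel L G (leftRegular (ξ : TwistedGroupRing L G) f) := by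
  cases nonempty_fintype G
  funext σ
  have h0 : ∀ τ, σ * τ⁻¹ ∉ kernel L G → coeff (ξ : TwistedGroupRing L G) (σ * τ⁻¹) = 0 :=
    fun τ => (mem_center_iff.1 ξ.2).1 _
  by_cases hσ : σ ∈ kernel L G
  · rw [restrictKernel_of_mem _ hσ, leftRegular_apply, leftRegular_apply, coeff_mul, coeff_mul]
    refine Finset.sum_congr rfl fun τ _ => ?_
    rw [coeff_coeffEquiv_symm, coeff_coeffEquiv_symm]
    by_cases hτ : τ ∈ kernel L G
    · rw [restrictKernel_of_mem _ hτ]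
    · rw [h0 τ fun h => hτ ?_]
      · simp
      · have := mul_mem (inv_mem h) hσ
        simpa using this
  · rw [restrictKernel_of_notMem _ hσ, leftRegular_apply, coeff_mul]
    refine Finset.sum_eq_zero fun τ _ => ?_
    rw [coeff_coeffEquiv_symm]
    by_cases hτ : τ ∈ kernel L G
    · rw [h0 τ fun h => hσ ?_]
      · simp
      · have := mul_mem h hτ
        simpa using this
    · rw [restrictKernel_of_notMem _ hτ, mul_zero]

/-- The diagonal entry at each of the `n` elements of `N` is the coefficient of `1`, untwisted
because `N` acts trivially; off `N` it is `0`. -/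
theorem trace_leftRegular_restrictKernel
    (ξ : Subalgebra.center (baseField L G) (TwistedGroupRing L G)) :
    LinearMap.trace L (G → L) (leftRegular (ξ : TwistedGroupRing L G) ∘ₗ restrictKernel L G) =
      (Nat.card (kernel L G) : L) * coeff (ξ : TwistedGroupRing L G) 1 := by
  classical
  cases nonempty_fintype G
  rw [LinearMap.trace_eq_matrix_trace L (Pi.basisFun L G), Matrix.trace]
  have h : ∀ σ : G, (LinearMap.toMatrix (Pi.basisFun L G) (Pi.basisFun L G)
      (leftRegular (ξ : TwistedGroupRing L G) ∘ₗ restrictKernel L G)).diag σ =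
      if σ ∈ kernel L G then coeff (ξ : TwistedGroupRing L G) 1 else 0 := by
    intro σ
    rw [Matrix.diag_apply, LinearMap.toMatrix_apply, Pi.basisFun_apply, Pi.basisFun_repr,
      LinearMap.comp_apply, leftRegular_restrictKernel]
    by_cases hσ : σ ∈ kernel L G
    · rw [restrictKernel_of_mem _ hσ, if_pos hσ, leftRegular_apply, coeff_mul,
        Finset.sum_eq_single σ]
      · rw [coeff_coeffEquiv_symm, Pi.single_eq_same, mul_one, mul_inv_cancel,
          mem_kernel.1 hσ]
      · intro τ _ hτ
        rw [coeff_coeffEquiv_symm, Pi.single_eq_of_ne hτ, mul_zero]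
      · simp
    · rw [restrictKernel_of_notMem _ hσ, if_neg hσ]
  rw [Finset.sum_congr rfl fun σ _ => h σ, ← Finset.sum_filter, Finset.sum_const, nsmul_eq_mul,
    ← Fintype.card_subtype, Nat.card_eq_fintype_card]

theorem conjEquiv_leftRegular (σ : G)
    (ξ : Subalgebra.center (baseField L G) (TwistedGroupRing L G)) (f : G → L) :
    conjEquiv σ (leftRegular (ξ : TwistedGroupRing L G) f) =
      leftRegular (ξ : TwistedGroupRing L G) (conjEquiv σ f) := by
  obtain ⟨η, rfl⟩ : ∃ η : TwistedGroupRing L G, coeff η = f := (coeffEquiv L G).surjective f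
  rw [leftRegular_coeff, conjEquiv_coeff, conjEquiv_coeff, leftRegular_coeff, ← mul_assoc,
    Subalgebra.mem_center_iff.1 ξ.2, mul_assoc, mul_assoc, mul_assoc]

/-- The part of the group ring of the kernel fixed by an element `e`. -/
noncomputable def kernelBlock (e : TwistedGroupRing L G) : Submodule L (G → L) where
  carrier := {f | leftRegular e f = f ∧ restrictKernel L G f = f}
  add_mem' hf hg := ⟨by rw [map_add, hf.1, hg.1], by rw [map_add, hf.2, hg.2]⟩
  zero_mem' := ⟨map_zero _, map_zero _⟩
  smul_mem' c f hf := ⟨by rw [map_smul, hf.1], by rw [map_smul, hf.2]⟩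

variable {Z : Type*} [Field Z] [Algebra (baseField L G) Z]

theorem leftRegular_mem_kernelBlock
    {s : Z →ₗ[baseField L G] Subalgebra.center (baseField L G) (TwistedGroupRing L G)}
    (hs : ∀ z z', s (z * z') = s z * s z') (z : Z) {f : G → L} (hf : restrictKernel L G f = f) :
    leftRegular (s z : TwistedGroupRing L G) f ∈ kernelBlock (s 1 : TwistedGroupRing L G) := by
  refine ⟨?_, ?_⟩
  · rw [← leftRegular_mul_apply, ← MulMemClass.coe_mul, ← hs, one_mul]
  · rw [← leftRegular_restrictKernel, hf]

/-- The action of an element of `Z` on the block of the group ring of the kernel. -/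
noncomputable def blockEnd
    (s : Z →ₗ[baseField L G] Subalgebra.center (baseField L G) (TwistedGroupRing L G))
    (hs : ∀ z z', s (z * z') = s z * s z') (z : Z) :
    Module.End L (kernelBlock (s 1 : TwistedGroupRing L G)) :=
  (leftRegular (s z : TwistedGroupRing L G)).restrict
    fun _ hf => leftRegular_mem_kernelBlock hs z hf.2

theorem coe_blockEnd_apply
    (s : Z →ₗ[baseField L G] Subalgebra.center (baseField L G) (TwistedGroupRing L G))
    (hs : ∀ z z', s (z * z') = s z * s z') (z : Z)
    (f : kernelBlock (s 1 : TwistedGroupRing L G)) :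
    (blockEnd s hs z f : G → L) = leftRegular (s z : TwistedGroupRing L G) (f : G → L) := rfl

theorem blockEnd_mul
    (s : Z →ₗ[baseField L G] Subalgebra.center (baseField L G) (TwistedGroupRing L G))
    (hs : ∀ z z', s (z * z') = s z * s z') (z z' : Z) :
    blockEnd s hs (z * z') = blockEnd s hs z * blockEnd s hs z' :=
  LinearMap.ext fun f => Subtype.ext <| by
    rw [Module.End.mul_apply, coe_blockEnd_apply, coe_blockEnd_apply, coe_blockEnd_apply,
      ← leftRegular_mul_apply, hs, MulMemClass.coe_mul]

/-- The action of `Z` on the block of the group ring of the kernel. -/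
noncomputable def blockAction
    (s : Z →ₗ[baseField L G] Subalgebra.center (baseField L G) (TwistedGroupRing L G))
    (hs : ∀ z z', s (z * z') = s z * s z') :
    Z →ₐ[baseField L G] Module.End L (kernelBlock (s 1 : TwistedGroupRing L G)) :=
  AlgHom.ofLinearMap
    { toFun := blockEnd s hs
      map_add' := fun z z' => LinearMap.ext fun f => Subtype.ext <| by
        rw [coe_blockEnd_apply, map_add, AddMemClass.coe_add, leftRegular_add]
        rfl
      map_smul' := fun c z => LinearMap.ext fun f => Subtype.ext <| by
        rw [coe_blockEnd_apply, map_smul, SetLike.val_smul, leftRegular_smul]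
        rfl }
    -- `s 1` is only an idempotent of the centre, but it acts as the identity on its own block by
    -- definition of the block.
    (LinearMap.ext fun f => Subtype.ext f.2.1)
    (blockEnd_mul s hs)

theorem coe_blockAction_apply
    (s : Z →ₗ[baseField L G] Subalgebra.center (baseField L G) (TwistedGroupRing L G))
    (hs : ∀ z z', s (z * z') = s z * s z') (z : Z)
    (f : kernelBlock (s 1 : TwistedGroupRing L G)) :
    (blockAction s hs z f : G → L) = leftRegular (s z : TwistedGroupRing L G) (f : G → L) := rfl

/-- Multiplication by `s z` after restriction to `N` has image in the block, so its trace on all of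
`G → L` is already the trace on the block. -/
theorem trace_blockAction
    (s : Z →ₗ[baseField L G] Subalgebra.center (baseField L G) (TwistedGroupRing L G))
    (hs : ∀ z z', s (z * z') = s z * s z') (z : Z) :
    LinearMap.trace L _ (blockAction s hs z) =
      (Nat.card (kernel L G) : L) * coeff (s z : TwistedGroupRing L G) 1 := by
  rw [← trace_leftRegular_restrictKernel, ← LinearMap.trace_restrict_eq_of_forall_mem
    (kernelBlock (s 1 : TwistedGroupRing L G))
    (leftRegular (s z : TwistedGroupRing L G) ∘ₗ restrictKernel L G)
    (fun f => leftRegular_mem_kernelBlock hs z (restrictKernel_restrictKernel f))]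
  congr 1
  refine LinearMap.ext fun f => Subtype.ext ?_
  rw [coe_blockAction_apply]
  change _ = leftRegular (s z : TwistedGroupRing L G) (restrictKernel L G (f : G → L))
  rw [f.2.2]

/-- Every automorphism of `L / K` is induced by some `g` in `G`, and conjugation by `g` is the
required semilinear bijection of the block; it commutes with `Z` because `s` has central values. -/
theorem exists_finrank_kernelBlock_eq [FiniteDimensional (baseField L G) Z]
    (s : Z →ₗ[baseField L G] Subalgebra.center (baseField L G) (TwistedGroupRing L G))
    (hs : ∀ z z', s (z * z') = s z * s z') :
    ∃ r : ℕ, Module.finrank L (kernelBlock (s 1 : TwistedGroupRing L G)) =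
        r * Module.finrank (baseField L G) Z ∧
      ∀ z, (Nat.card (kernel L G) : baseField L G) * centralCoeff L G (s z) =
        (r : baseField L G) * Algebra.trace (baseField L G) Z z := by
  obtain ⟨r, hr, ht⟩ := exists_finrank_trace_eq (baseField L G) L Z
    (kernelBlock (s 1 : TwistedGroupRing L G)) (blockAction s hs) fun γ => by
      obtain ⟨g, hg⟩ := toAlgAut_surjective_of_isInvariant Gᵐᵒᵖ (baseField L G) L γ
      have hγ : ∀ y, γ y = y <• g.unop := fun y => by rw [← hg]; rfl
      have hmem : ∀ (σ : G) (f : G → L), f ∈ kernelBlock (s 1 : TwistedGroupRing L G) →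
          conjEquiv σ f ∈ kernelBlock (s 1 : TwistedGroupRing L G) := fun σ f hf =>
        ⟨by rw [← conjEquiv_leftRegular, hf.1], by rw [← conjEquiv_restrictKernel, hf.2]⟩
      refine ⟨{ toFun := fun f => ⟨conjEquiv g.unop f, hmem _ _ f.2⟩
                invFun := fun f => ⟨(conjEquiv g.unop).symm f, ?_⟩
                left_inv := fun f => Subtype.ext ((conjEquiv g.unop).symm_apply_apply _)
                right_inv := fun f => Subtype.ext ((conjEquiv g.unop).apply_symm_apply _)
                map_add' := fun f f' => Subtype.ext (map_add (conjEquiv g.unop) _ _) },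
        fun y f => Subtype.ext ?_, fun z f => Subtype.ext ?_⟩
      · have h := hmem g.unop⁻¹ f f.2
        convert h using 1
        refine (conjEquiv g.unop).injective (funext fun ρ => ?_)
        rw [AddEquiv.apply_symm_apply, conjEquiv_apply, conjEquiv_apply, ← smul_mul_op]
        simp [mul_assoc]
      · rw [hγ]
        exact conjEquiv_smul _ _ _
      · exact conjEquiv_leftRegular _ _ _
  refine ⟨r, hr, fun z => Subtype.ext ?_⟩
  have h := (trace_blockAction s hs z).symm.trans (ht z)
  push_cast
  exact h

end KernelTrace

/-! ### Dimension of a block through the cosets of the kernel. -/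

section BlockDimension

variable {L G : Type*} [Field L] [Group G]

/-- Translation by `σ` in coordinates. -/
noncomputable def translate (σ : G) : (G → L) →ₗ[L] (G → L) :=
  LinearMap.funLeft L L fun ρ => σ * ρ

theorem translate_apply (σ ρ : G) (f : G → L) : translate σ f ρ = f (σ * ρ) := rfl

variable [MulSemiringAction Gᵐᵒᵖ L]

theorem translate_coeff (σ : G) (η : TwistedGroupRing L G) :
    translate σ (coeff η) = coeff (single σ⁻¹ 1 * η) := funext fun ρ => by
  rw [translate_apply, coeff_single_mul, inv_inv, smul_one, one_mul]

variable [Finite G]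

theorem translate_leftRegular (σ : G)
    (ξ : Subalgebra.center (baseField L G) (TwistedGroupRing L G)) (f : G → L) :
    translate σ (leftRegular (ξ : TwistedGroupRing L G) f) =
      leftRegular (ξ : TwistedGroupRing L G) (translate σ f) := by
  obtain ⟨η, rfl⟩ : ∃ η : TwistedGroupRing L G, coeff η = f := (coeffEquiv L G).surjective f
  rw [leftRegular_coeff, translate_coeff, translate_coeff, leftRegular_coeff, ← mul_assoc,
    Subalgebra.mem_center_iff.1 ξ.2, mul_assoc]

/-- The part of the twisted group ring fixed by an element `e`, in coordinates. -/
noncomputable def ringBlock (e : TwistedGroupRing L G) : Submodule L (G → L) where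
  carrier := {f | leftRegular e f = f}
  add_mem' {f g} (hf : leftRegular e f = f) (hg : leftRegular e g = g) := by
    change leftRegular e (f + g) = f + g
    rw [map_add, hf, hg]
  zero_mem' := map_zero _
  smul_mem' c f (hf : leftRegular e f = f) := by
    change leftRegular e (c • f) = c • f
    rw [map_smul, hf]

theorem mem_ringBlock {e : TwistedGroupRing L G} {f : G → L} :
    f ∈ ringBlock e ↔ leftRegular e f = f := Iff.rfl

/-- The decomposition of a block along the cosets of the kernel. -/
noncomputable def cosetDecomposition
    (e : Subalgebra.center (baseField L G) (TwistedGroupRing L G)) :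
    ringBlock (e : TwistedGroupRing L G) →ₗ[L]
      (G ⧸ kernel L G → kernelBlock (e : TwistedGroupRing L G)) :=
  LinearMap.pi fun c => (restrictKernel L G ∘ₗ translate c.out).restrict fun f hf => by
    refine ⟨?_, restrictKernel_restrictKernel _⟩
    rw [LinearMap.comp_apply, leftRegular_restrictKernel, ← translate_leftRegular,
      mem_ringBlock.1 hf]

theorem coe_cosetDecomposition_apply
    (e : Subalgebra.center (baseField L G) (TwistedGroupRing L G))
    (f : ringBlock (e : TwistedGroupRing L G)) (c : G ⧸ kernel L G) :
    (cosetDecomposition e f c : G → L) = restrictKernel L G (translate c.out (f : G → L)) := rfl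

/-- Left translation commutes with the central `e`, so cutting a function along the cosets of `N`
and moving each piece back to `N` stays inside the block. -/
theorem cosetDecomposition_bijective
    (e : Subalgebra.center (baseField L G) (TwistedGroupRing L G)) :
    Function.Bijective (cosetDecomposition e) := by
  classical
  constructor
  · rw [injective_iff_map_eq_zero]
    intro f hf
    refine Subtype.ext (funext fun σ => ?_)
    have h1 := congrArg Subtype.val (congrFun hf (σ : G ⧸ kernel L G))
    have h2 := congrFun h1 ((σ : G ⧸ kernel L G).out⁻¹ * σ)
    rw [coe_cosetDecomposition_apply, restrictKernel_of_mem, translate_apply,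
      mul_inv_cancel_left] at h2
    · exact h2
    · rw [← QuotientGroup.eq]
      exact Quotient.out_eq' _
  · intro g
    have := Fintype.ofFinite (G ⧸ kernel L G)
    -- Each `g c`, supported on `N`, is moved out to the coset `c`; the supports are disjoint.
    refine ⟨⟨∑ c, translate c.out⁻¹ (g c : G → L), ?_⟩, funext fun c => Subtype.ext (funext fun σ => ?_)⟩
    · refine Submodule.sum_mem _ fun c _ => ?_
      rw [mem_ringBlock, ← translate_leftRegular, (g c).2.1]
    · rw [coe_cosetDecomposition_apply]
      have hg : ∀ c, ∀ σ ∉ kernel L G, (g c : G → L) σ = 0 := fun c =>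
        (restrictKernel_eq_self_iff _).1 (g c).2.2
      by_cases hσ : σ ∈ kernel L G
      · rw [restrictKernel_of_mem _ hσ, translate_apply]
        change (∑ c, translate c.out⁻¹ (g c : G → L)) (c.out * σ) = _
        rw [Finset.sum_apply, Finset.sum_eq_single c]
        · rw [translate_apply, inv_mul_cancel_left]
        · intro d _ hd
          rw [translate_apply]
          refine hg d _ fun hmem => hd ?_
          rw [← mul_assoc] at hmem
          have h1 : d.out⁻¹ * c.out ∈ kernel L G := by
            have := mul_mem hmem (inv_mem hσ)
            simpa using this
          rw [← QuotientGroup.eq] at h1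
          rwa [QuotientGroup.out_eq', QuotientGroup.out_eq'] at h1
        · simp
      · rw [restrictKernel_of_notMem _ hσ, hg c σ hσ]

theorem index_kernel : (kernel L G).index = Module.finrank (baseField L G) L := by
  have h1 := (kernel L G).card_mul_index
  rw [card_eq_card_kernel_mul_finrank (L := L) (G := G)] at h1
  exact Nat.eq_of_mul_eq_mul_left Nat.card_pos h1

theorem finrank_ringBlock
    (e : Subalgebra.center (baseField L G) (TwistedGroupRing L G)) :
    Module.finrank L (ringBlock (e : TwistedGroupRing L G)) =
      Module.finrank (baseField L G) L *
        Module.finrank L (kernelBlock (e : TwistedGroupRing L G)) := by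
  have := Fintype.ofFinite (G ⧸ kernel L G)
  rw [(LinearEquiv.ofBijective _ (cosetDecomposition_bijective e)).finrank_eq,
    Module.finrank_pi_fintype, Finset.sum_const, smul_eq_mul, ← index_kernel, Subgroup.index,
    Nat.card_eq_fintype_card]
  rfl

variable (L G) in
/-- The coordinates of an element of the opposite of `L ≀ G`. -/
noncomputable def opCoeffEquiv : (TwistedGroupRing L G)ᵐᵒᵖ ≃ₗ[baseField L G] (G → L) :=
  (MulOpposite.opLinearEquiv (baseField L G)).symm ≪≫ₗ coeffEquiv L G

/-- One factor `h` counts the cosets of `N`, the other passes from `L` to `K`. Left multiplication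
in the opposite ring is right multiplication by `e`, which agrees with left multiplication as `e` is
central. -/
theorem finrank_range_mulLeft
    (e : Subalgebra.center (baseField L G) (TwistedGroupRing L G)) (he : e * e = e) :
    Module.finrank (baseField L G) (LinearMap.range (LinearMap.mulLeft (baseField L G)
      (MulOpposite.op (e : TwistedGroupRing L G)))) =
      Module.finrank (baseField L G) L * (Module.finrank (baseField L G) L *
        Module.finrank L (kernelBlock (e : TwistedGroupRing L G))) := by
  rw [← finrank_ringBlock, Module.finrank_mul_finrank,
    ((opCoeffEquiv L G).submoduleMap _).finrank_eq]
  have h : (LinearMap.range (LinearMap.mulLeft (baseField L G)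
      (MulOpposite.op (e : TwistedGroupRing L G)))).map
        ((opCoeffEquiv L G : (TwistedGroupRing L G)ᵐᵒᵖ →ₗ[baseField L G] (G → L))) =
      (ringBlock (e : TwistedGroupRing L G)).restrictScalars (baseField L G) := by
    have he' : (e * e : TwistedGroupRing L G) = e := congrArg Subtype.val he
    have hc := Subalgebra.mem_center_iff.1 e.2
    ext f
    constructor
    · rintro ⟨_, ⟨t, rfl⟩, rfl⟩
      change leftRegular (e : TwistedGroupRing L G) (coeff (t.unop * (e : TwistedGroupRing L G))) =
        coeff (t.unop * (e : TwistedGroupRing L G))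
      rw [leftRegular_coeff, hc, ← mul_assoc, he']
    · intro hf
      refine ⟨_, ⟨(opCoeffEquiv L G).symm f, rfl⟩, ?_⟩
      rw [Submodule.restrictScalars_mem, mem_ringBlock] at hf
      change coeff ((coeffEquiv L G).symm f * (e : TwistedGroupRing L G)) = f
      rw [hc]
      exact hf
  rw [h]
  rfl

end BlockDimension

/-! ### Decomposition of the centre and the Plancherel formula. -/

section Plancherel

theorem finite_op {L G : Type*} [Field L] [Group G] [MulSemiringAction Gᵐᵒᵖ L] [Finite G] :
    Module.Finite (baseField L G) (TwistedGroupRing L G)ᵐᵒᵖ :=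
  Module.Finite.equiv (opCoeffEquiv L G).symm

theorem finite_center_end (K T X : Type*) [Field K] [Ring T] [Algebra K T] [Module.Finite K T]
    [AddCommGroup X] [Module T X] [Module K X] [IsScalarTower K T X] [IsSimpleModule T X] :
    Module.Finite K (Subalgebra.center K (Module.End T X)) := by
  have : Module.Finite K X := finite_of_isSimpleModule K (T := T)
  let f : Subalgebra.center K (Module.End T X) →ₗ[K] Module.End K X :=
    { toFun := fun z => (z : Module.End T X).restrictScalars K
      map_add' := fun _ _ => rfl
      map_smul' := fun _ _ => rfl }
  refine Module.Finite.of_injective f fun a b h => Subtype.ext (LinearMap.ext fun x => ?_)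
  exact LinearMap.congr_fun h x

variable {L : Type u} {G : Type v} [Field L] [Group G] [MulSemiringAction Gᵐᵒᵖ L]
  {ι : Type*} {X : ι → Type w} [∀ i, AddCommGroup (X i)]
  [∀ i, Module (TwistedGroupRing L G)ᵐᵒᵖ (X i)]

theorem IsCompleteSimpleFamily.eq_zero_of_smul_eq_zero [Finite G]
    (hX : IsCompleteSimpleFamily L G X)
    (hn : (Nat.card (kernel L G) : baseField L G) ≠ 0) (t : (TwistedGroupRing L G)ᵐᵒᵖ)
    (ht : ∀ i (x : X i), t • x = 0) : t = 0 := by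
  have := isSemisimpleModule (L := L) (G := G) hn (TwistedGroupRing L G)ᵐᵒᵖ
  -- Quantifying over all annihilators `s`, not just `t`, makes `W` stable under left
  -- multiplication. It contains every simple submodule, hence `1`.
  let W : Submodule (TwistedGroupRing L G)ᵐᵒᵖ (TwistedGroupRing L G)ᵐᵒᵖ :=
    { carrier := {m | ∀ s : (TwistedGroupRing L G)ᵐᵒᵖ, (∀ i (x : X i), s • x = 0) → s * m = 0}
      add_mem' := fun ha hb s hs => by rw [mul_add, ha s hs, hb s hs, add_zero]
      zero_mem' := fun s _ => mul_zero s
      smul_mem' := fun c m hm s hs => by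
        rw [smul_eq_mul, ← mul_assoc]
        exact hm _ fun i x => by rw [mul_smul, hs] }
  have hW : W = ⊤ := by
    rw [eq_top_iff, ← IsSemisimpleModule.sSup_simples_eq_top, sSup_le_iff]
    intro S hS m hm s hs
    obtain ⟨i, ⟨e⟩⟩ := hX.exists_equiv S hS
    have h : s • (⟨m, hm⟩ : S) = 0 := e.injective (by rw [map_smul, hs, map_zero])
    exact congrArg Subtype.val h
  have h1 : (1 : (TwistedGroupRing L G)ᵐᵒᵖ) ∈ W := hW ▸ Submodule.mem_top
  rw [← mul_one t]
  exact h1 t ht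

variable [∀ i, Module (baseField L G) (X i)]
  [∀ i, IsScalarTower (baseField L G) (TwistedGroupRing L G)ᵐᵒᵖ (X i)]

theorem centralAction_apply (i : ι)
    (ξ : Subalgebra.center (baseField L G) (TwistedGroupRing L G)) (x : X i) :
    (centralAction (X i) ξ : EndRing L G (X i)) x =
      MulOpposite.op (ξ : TwistedGroupRing L G) • x := rfl

theorem centralAction_add (i : ι)
    (ξ η : Subalgebra.center (baseField L G) (TwistedGroupRing L G)) :
    centralAction (X i) (ξ + η) = centralAction (X i) ξ + centralAction (X i) η :=
  Subtype.ext (LinearMap.ext fun x => add_smul (MulOpposite.op (ξ : TwistedGroupRing L G))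
    (MulOpposite.op (η : TwistedGroupRing L G)) x)

theorem centralAction_smul (i : ι) (c : baseField L G)
    (ξ : Subalgebra.center (baseField L G) (TwistedGroupRing L G)) :
    centralAction (X i) (c • ξ) = c • centralAction (X i) ξ :=
  Subtype.ext (LinearMap.ext fun x => smul_assoc c (MulOpposite.op (ξ : TwistedGroupRing L G)) x)

theorem centralAction_mul (i : ι)
    (ξ η : Subalgebra.center (baseField L G) (TwistedGroupRing L G)) :
    centralAction (X i) (ξ * η) = centralAction (X i) ξ * centralAction (X i) η := by
  -- A right action reverses products; commutativity of the centre compensates.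
  rw [mul_comm]
  exact Subtype.ext (LinearMap.ext fun x => mul_smul (MulOpposite.op (ξ : TwistedGroupRing L G))
    (MulOpposite.op (η : TwistedGroupRing L G)) x)

variable (X) in
/-- The operation of the centre of `L ≀ G` on all modules of a family. -/
noncomputable def centralActions :
    Subalgebra.center (baseField L G) (TwistedGroupRing L G) →ₗ[baseField L G]
      ∀ i, Subalgebra.center (baseField L G) (EndRing L G (X i)) where
  toFun ξ i := centralAction (X i) ξ
  map_add' ξ η := funext fun i => centralAction_add i ξ η
  map_smul' c ξ := funext fun i => centralAction_smul i c ξ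

variable [Finite G]

theorem IsCompleteSimpleFamily.ext_centralAction (hX : IsCompleteSimpleFamily L G X)
    (hn : (Nat.card (kernel L G) : baseField L G) ≠ 0)
    {ξ η : Subalgebra.center (baseField L G) (TwistedGroupRing L G)}
    (h : ∀ i, centralAction (X i) ξ = centralAction (X i) η) : ξ = η := by
  refine Subtype.ext (MulOpposite.op_injective (sub_eq_zero.1
    (hX.eq_zero_of_smul_eq_zero hn _ fun i x => ?_)))
  rw [sub_smul, ← centralAction_apply, ← centralAction_apply, h, sub_self]

variable [Fintype ι]

/-- The centre is the product of the `Z(K_i)`: injectivity is faithfulness on the simple modules,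
surjectivity the double centralizer theorem. -/
theorem IsCompleteSimpleFamily.centralActions_bijective (hX : IsCompleteSimpleFamily L G X)
    (hn : (Nat.card (kernel L G) : baseField L G) ≠ 0) :
    Function.Bijective (centralActions (L := L) (G := G) X) := by
  have : IsSemisimpleRing (TwistedGroupRing L G)ᵐᵒᵖ := isSemisimpleModule hn _
  have := finite_op (L := L) (G := G)
  refine ⟨fun ξ η h => hX.ext_centralAction hn fun i => congrFun h i, fun z => ?_⟩
  obtain ⟨t, ht, htz⟩ := exists_center_smul_eq_of_simple_family (K := baseField L G) hX.simple
    hX.eq_of_equiv (hX.eq_zero_of_smul_eq_zero hn) z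
  refine ⟨⟨t.unop, Subalgebra.mem_center_iff.2 fun b => ?_⟩, funext fun i => Subtype.ext
    (LinearMap.ext fun x => htz i x)⟩
  exact congrArg MulOpposite.unop (Subalgebra.mem_center_iff.1 ht (MulOpposite.op b)).symm

/-- Central elements operating on a single module of the family. -/
theorem IsCompleteSimpleFamily.exists_section [DecidableEq ι] (hX : IsCompleteSimpleFamily L G X)
    (hn : (Nat.card (kernel L G) : baseField L G) ≠ 0) (i : ι) :
    ∃ s : Subalgebra.center (baseField L G) (EndRing L G (X i)) →ₗ[baseField L G]
        Subalgebra.center (baseField L G) (TwistedGroupRing L G),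
      (∀ z, centralActions X (s z) = Pi.single i z) ∧ ∀ z z', s (z * z') = s z * s z' := by
  let e := LinearEquiv.ofBijective (centralActions X) (hX.centralActions_bijective hn)
  have h : ∀ z, centralActions X (e.symm (Pi.single i z)) = Pi.single i z := fun z =>
    e.apply_symm_apply _
  refine ⟨e.symm.toLinearMap ∘ₗ LinearMap.single (baseField L G)
    (fun i => Subalgebra.center (baseField L G) (EndRing L G (X i))) i, h, fun z z' => ?_⟩
  refine (hX.centralActions_bijective hn).1 ?_
  refine (h (z * z')).trans ?_
  funext j
  refine Eq.trans ?_ (centralAction_mul j _ _).symm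
  have h1 := congrFun (h z) j
  have h2 := congrFun (h z') j
  refine Eq.trans ?_ (congrArg₂ (· * ·) h1 h2).symm
  rw [Pi.single_mul]
  rfl

/-- The rank `r` of the block of `L N` over `L ⊗ Z(K_i)` governs the trace. It is found by computing
the `K`-dimension of the block of `L ≀ G` both along cosets and as `End_{K_i}(X i)`. -/
theorem IsCompleteSimpleFamily.block_formula [DecidableEq ι] (hX : IsCompleteSimpleFamily L G X)
    (hn : (Nat.card (kernel L G) : baseField L G) ≠ 0) (i : ι) :
    Module.finrank (baseField L G) L ∣ dimEnd L G (X i) * schurIndex L G (X i) ∧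
    ∀ ξ : Subalgebra.center (baseField L G) (TwistedGroupRing L G),
      (∀ j ≠ i, centralAction (X j) ξ = 0) →
      (Nat.card (kernel L G) : baseField L G) * centralCoeff L G ξ =
        ((dimEnd L G (X i) * schurIndex L G (X i) / Module.finrank (baseField L G) L : ℕ) :
          baseField L G) ^ 2 *
        Algebra.trace (baseField L G) (Subalgebra.center (baseField L G) (EndRing L G (X i)))
          (centralAction (X i) ξ) := by
  have : IsSemisimpleRing (TwistedGroupRing L G)ᵐᵒᵖ := isSemisimpleModule hn _
  have := finite_op (L := L) (G := G)
  have := hX.simple i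
  let : Field (Subalgebra.center (baseField L G) (EndRing L G (X i))) :=
    (isField_center_end (baseField L G) (TwistedGroupRing L G)ᵐᵒᵖ (X i)).toField
  have : Module.Finite (baseField L G)
      (Subalgebra.center (baseField L G) (EndRing L G (X i))) :=
    finite_center_end (baseField L G) (TwistedGroupRing L G)ᵐᵒᵖ (X i)
  obtain ⟨s, hs, hsm⟩ := hX.exists_section hn i
  obtain ⟨r, hr, ht⟩ := exists_finrank_kernelBlock_eq s hsm
  have he : s 1 * s 1 = s 1 := by rw [← hsm, one_mul]
  have hblock := finrank_block_eq (K := baseField L G) hX.simple hX.eq_of_equiv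
    (hX.eq_zero_of_smul_eq_zero hn) i (MulOpposite.op (s 1 : TwistedGroupRing L G))
    (fun x => by
      have h : centralAction (X i) (s 1) = 1 := (congrFun (hs 1) i).trans (Pi.single_eq_same i _)
      rw [← centralAction_apply, h]
      rfl)
    (fun j hj x => by
      have h : centralAction (X j) (s 1) = 0 :=
        (congrFun (hs 1) j).trans (Pi.single_eq_of_ne hj _)
      rw [← centralAction_apply, h]
      rfl)
  rw [finrank_range_mulLeft _ he, hr, ← sqrt_finrank_center_end_sq] at hblock
  have hz : 0 < Module.finrank (baseField L G)
      (Subalgebra.center (baseField L G) (EndRing L G (X i))) := Module.finrank_pos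
  have hh : 0 < Module.finrank (baseField L G) L := Module.finrank_pos
  -- Cancel `[Z(K_i) : K]` in the two dimension formulas. This is an identity of natural numbers, so
  -- it determines `r` in any characteristic.
  have hsq : Module.finrank (baseField L G) L ^ 2 * r =
      (dimEnd L G (X i) * schurIndex L G (X i)) ^ 2 := by
    refine Nat.eq_of_mul_eq_mul_right hz ?_
    rw [dimEnd, schurIndex, mul_pow]
    linarith
  have hdvd : Module.finrank (baseField L G) L ∣ dimEnd L G (X i) * schurIndex L G (X i) :=
    (Nat.pow_dvd_pow_iff two_ne_zero).1 ⟨r, hsq.symm⟩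
  refine ⟨hdvd, fun ξ hξ => ?_⟩
  -- A central element acting as zero on all other simples lies in the image of the section `s`.
  have hξs : ξ = s (centralAction (X i) ξ) := by
    refine hX.ext_centralAction hn fun j => ?_
    have h := congrFun (hs (centralAction (X i) ξ)) j
    refine Eq.trans ?_ h.symm
    by_cases hj : j = i
    · subst hj
      rw [Pi.single_eq_same]
    · rw [Pi.single_eq_of_ne hj, hξ j hj]
  have hr2 : r = (dimEnd L G (X i) * schurIndex L G (X i) / Module.finrank (baseField L G) L) ^ 2 := by
    obtain ⟨c, hc⟩ := hdvd
    rw [hc, mul_pow] at hsq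
    rw [hc, Nat.mul_div_cancel_left c hh]
    exact Nat.eq_of_mul_eq_mul_left (pow_pos hh 2) hsq
  rw [← Nat.cast_pow, ← hr2]
  have h := ht (centralAction (X i) ξ)
  rw [← hξs] at h
  exact h

theorem IsCompleteSimpleFamily.centralCoeff_eq_sum (hX : IsCompleteSimpleFamily L G X)
    (hn : (Nat.card (kernel L G) : baseField L G) ≠ 0)
    (ξ : Subalgebra.center (baseField L G) (TwistedGroupRing L G)) :
    centralCoeff L G ξ = ∑ i, (Nat.card (kernel L G) : baseField L G)⁻¹ *
      ((dimEnd L G (X i) * schurIndex L G (X i) / Module.finrank (baseField L G) L : ℕ) :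
        baseField L G) ^ 2 *
      Algebra.trace (baseField L G) (Subalgebra.center (baseField L G) (EndRing L G (X i)))
        (centralAction (X i) ξ) := by
  classical
  choose s hs _ using hX.exists_section hn
  have hξ : ξ = ∑ i, s i (centralAction (X i) ξ) := by
    refine (hX.centralActions_bijective hn).1 ?_
    rw [map_sum, Finset.sum_congr rfl fun i _ => hs i _]
    exact (Finset.univ_sum_single (fun i => centralAction (X i) ξ)).symm
  conv_lhs => rw [hξ]
  rw [map_sum]
  refine Finset.sum_congr rfl fun i _ => ?_
  have h1 : centralAction (X i) (s i (centralAction (X i) ξ)) = centralAction (X i) ξ :=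
    (congrFun (hs i _) i).trans (Pi.single_eq_same i _)
  have h2 := (hX.block_formula hn i).2 (s i (centralAction (X i) ξ)) fun j hj =>
    (congrFun (hs i _) j).trans (Pi.single_eq_of_ne hj _)
  rw [h1] at h2
  rw [mul_assoc, ← h2, inv_mul_cancel_left₀ hn]

end Plancherel

end TwistedGroupRing

theorem mainTheorem7 {L : Type u} {G : Type v} [Field L] [Group G] [Finite G]
    [MulSemiringAction Gᵐᵒᵖ L]
    (hn : (Nat.card (TwistedGroupRing.kernel L G) : TwistedGroupRing.baseField L G) ≠ 0)
    {ι : Type*} [Fintype ι] (X : ι → Type w) [∀ i, AddCommGroup (X i)]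
    [∀ i, Module (TwistedGroupRing L G)ᵐᵒᵖ (X i)]
    [∀ i, Module (TwistedGroupRing.baseField L G) (X i)]
    [∀ i, IsScalarTower (TwistedGroupRing.baseField L G) (TwistedGroupRing L G)ᵐᵒᵖ (X i)]
    (hX : TwistedGroupRing.IsCompleteSimpleFamily L G X) :
    -- the form `(-,=)^Z` is well defined
    (∃! B : LinearMap.BilinForm (TwistedGroupRing.baseField L G)
        (Subalgebra.center (TwistedGroupRing.baseField L G) (TwistedGroupRing L G)),
      TwistedGroupRing.IsCentralForm B) ∧
    -- the integers `d_i` with `d_i ^ 2 = [K_i : Z(K_i)]` and the quotients `x_i d_i / h` exist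
    (∀ i, TwistedGroupRing.schurIndex L G (X i) ^ 2 =
      Module.finrank (Subring.center (TwistedGroupRing.EndRing L G (X i)))
        (TwistedGroupRing.EndRing L G (X i))) ∧
    (∀ i, Module.finrank (TwistedGroupRing.baseField L G) L ∣
      TwistedGroupRing.dimEnd L G (X i) * TwistedGroupRing.schurIndex L G (X i)) ∧
    ∀ B : LinearMap.BilinForm (TwistedGroupRing.baseField L G)
        (Subalgebra.center (TwistedGroupRing.baseField L G) (TwistedGroupRing L G)),
      TwistedGroupRing.IsCentralForm B →
        B.IsSymm ∧
        ∀ ξ ξ' : Subalgebra.center (TwistedGroupRing.baseField L G) (TwistedGroupRing L G),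
          B ξ ξ' = ∑ i,
            (Nat.card (TwistedGroupRing.kernel L G) : TwistedGroupRing.baseField L G)⁻¹ *
            ((TwistedGroupRing.dimEnd L G (X i) * TwistedGroupRing.schurIndex L G (X i) /
                Module.finrank (TwistedGroupRing.baseField L G) L : ℕ) :
              TwistedGroupRing.baseField L G) ^ 2 *
            Algebra.trace (TwistedGroupRing.baseField L G)
              (Subalgebra.center (TwistedGroupRing.baseField L G)
                (TwistedGroupRing.EndRing L G (X i)))
              (TwistedGroupRing.centralAction (X i) ξ *
                TwistedGroupRing.centralAction (X i) ξ') := by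
  open TwistedGroupRing in
  have hform := isCentralForm_centralForm (L := L) (G := G) hn
  refine ⟨⟨_, hform, fun B hB => hB.eq hform⟩, fun i => ?_,
    fun i => ?_, fun B hB => ?_⟩
  · have := hX.simple i
    exact sqrt_finrank_center_end_sq (TwistedGroupRing L G)ᵐᵒᵖ (X i)
  · classical exact (hX.block_formula hn i).1
  · obtain rfl := hB.eq hform
    refine ⟨TwistedGroupRing.centralForm_isSymm, fun ξ ξ' => ?_⟩
    rw [TwistedGroupRing.centralForm_apply, hX.centralCoeff_eq_sum hn]
    exact Finset.sum_congr rfl fun i _ => by rw [TwistedGroupRing.centralAction_mul]
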